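/- Let $C\in\mathbb R^{n\times n}$ be symmetric positive definite, let $A_1,\dots,A_m\in\mathbb R^{n\times n}$ be symmetric and $b\in\mathbb R^m$. Consider the positive semidefinite program $$\min\{\operatorname{tr}(CX) : \operatorname{tr}(A_\ell X)=b_\ell\ (\ell=1,\dots,m),\ X\succeq 0\}.\qquad(\ast)$$ Let $\mathcal A$ be the $m\times n^2$ matrix with rows $\operatorname{vec}(A_\ell)^T$, so that the linear constraints read $\mathcal A\operatorname{vec}(X)=b$, and let $M^\dagger$ denote the Moore–Penrose pseudoinverse of $M$. The second-ansatz Physarum dynamic is the differential equation $$\operatorname{vec}(\dot X)=-\bigl(I-G\mathcal A^T(\mathcal A G\mathcal A^T)^\dagger\mathcal A\bigr)\,G\operatorname{vec}(C),\qquad G=X\otimes X.$$ Let $F\succ0$ satisfy $\mathcal A\operatorname{vec}(F)=b$. Then: 1. For every $t\ge 0$ the problem $$\min\{\,t\operatorname{tr}(CX)-\ln\det X+\operatorname{tr}(F^{-1}X) : \mathcal A\operatorname{vec}(X)=b,\ X\succ0\,\}$$ has a unique minimizer $X(t)$. 2. $X(0)=F$, and $t\mapsto X(t)$ solves the second-ansatz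 dynamic on $[0,\infty)$. It is the only solution starting at $F$: if $T\in\mathbb R$ and $Y$ solves the dynamic on $[0,T)$ with $Y(0)=F$, then $Y=X$ on $[0,T)$. 3. Consequently, the solution $Y$ of the second-ansatz dynamic on $[0,\infty)$ with $Y(0)=F$ converges, as $t\to\infty$, to an optimal solution of $(\ast)$. As $F$ was arbitrary, this holds from every feasible starting point $Y(0)\succ0$. -/

import Mathlib

open Matrix Filter Topology
open scoped Kronecker

/-! ### The Moore-Penrose pseudoinverse of a real matrix -/

/-- `P` satisfies the four Penrose equations for `M`. -/
structure IsMoorePenrose {k l : Type*} [Fintype k] [Fintype l]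
    (M : Matrix k l ℝ) (P : Matrix l k ℝ) : Prop where
  mul_mul_left : M * P * M = M
  mul_mul_right : P * M * P = P
  symm_left : (M * P)ᵀ = M * P
  symm_right : (P * M)ᵀ = P * M

theorem exists_isMoorePenrose {k l : Type*} [Fintype k] [Fintype l]
    (M : Matrix k l ℝ) : ∃ P, IsMoorePenrose M P := by
  classical
  have hH : (Mᵀ * M).IsHermitian := by
    simpa [conjTranspose_eq_transpose_of_trivial] using isHermitian_conjTranspose_mul_self M
  set H := Mᵀ * M with hHdef
  have hHt : Hᵀ = H := by simp [hHdef, transpose_mul]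
  obtain ⟨K, hKt, hHKH, hKHK, hcomm⟩ : ∃ K : Matrix l l ℝ,
      Kᵀ = K ∧ H * K * H = H ∧ K * H * K = K ∧ K * H = H * K := by
    have hspec := hH.spectral_theorem
    rw [Unitary.conjStarAlgAut_apply] at hspec
    set U : Matrix l l ℝ := (hH.eigenvectorUnitary : Matrix l l ℝ) with hU
    set d : l → ℝ := hH.eigenvalues with hd
    have hUU : star U * U = 1 := Unitary.coe_star_mul_self hH.eigenvectorUnitary
    have hsp : H = U * diagonal d * star U := by
      simpa [Function.comp_def] using hspec
    have key : ∀ a b : l → ℝ, (U * diagonal a * star U) * (U * diagonal b * star U)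
        = U * diagonal (fun i => a i * b i) * star U := by
      intro a b
      calc (U * diagonal a * star U) * (U * diagonal b * star U)
          = U * diagonal a * (star U * U) * diagonal b * star U := by
            simp only [Matrix.mul_assoc]
        _ = _ := by rw [hUU, Matrix.mul_one, Matrix.mul_assoc U, diagonal_mul_diagonal]
    refine ⟨U * diagonal (fun i => (d i)⁻¹) * star U, ?_, ?_, ?_, ?_⟩
    · simp [star_eq_conjTranspose, conjTranspose_eq_transpose_of_trivial, transpose_mul,
        Matrix.mul_assoc]
    · rw [hsp, key, key]; simp
    · rw [hsp, key, key]
      congr 3; funext i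
      by_cases h : d i = 0 <;> simp [h]
    · rw [hsp, key, key]; simp only [mul_comm]
  have hMKH : M * K * H = M := by
    have h0 : (M * K * H - M)ᵀ * (M * K * H - M) = 0 := by
      have : Mᵀ * (M * K * H - M) = 0 := by
        have h1 : Mᵀ * (M * K * H) = H * K * H := by
          simp only [hHdef, Matrix.mul_assoc]
        rw [Matrix.mul_sub, h1, hHKH, ← hHdef, sub_self]
      have h2 : (M * K * H - M)ᵀ = (K * H - 1)ᵀ * Mᵀ := by
        rw [← transpose_mul, Matrix.mul_sub, Matrix.mul_one, Matrix.mul_assoc M]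
      rw [h2, Matrix.mul_assoc, this, Matrix.mul_zero]
    rw [← conjTranspose_eq_transpose_of_trivial, conjTranspose_mul_self_eq_zero] at h0
    exact sub_eq_zero.mp h0
  refine ⟨K * Mᵀ, ⟨?_, ?_, ?_, ?_⟩⟩
  · calc M * (K * Mᵀ) * M = M * K * H := by simp only [hHdef, Matrix.mul_assoc]
      _ = M := hMKH
  · calc K * Mᵀ * M * (K * Mᵀ) = K * H * K * Mᵀ := by simp only [hHdef, Matrix.mul_assoc]
      _ = K * Mᵀ := by rw [hKHK]
  · simp [transpose_mul, hKt, Matrix.mul_assoc]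
  · have : K * Mᵀ * M = K * H := by simp only [hHdef, Matrix.mul_assoc]
    rw [this, transpose_mul, hKt, hHt, hcomm]

theorem IsMoorePenrose.unique {k l : Type*} [Fintype k] [Fintype l]
    {M : Matrix k l ℝ} {P Q : Matrix l k ℝ} (hP : IsMoorePenrose M P)
    (hQ : IsMoorePenrose M Q) : P = Q := by
  have h1 : M * P = M * Q := by
    calc M * P = (M * P)ᵀ := hP.symm_left.symm
      _ = ((M * Q) * (M * P))ᵀ := by
        rw [← Matrix.mul_assoc, hQ.mul_mul_left]
      _ = (M * P) * (M * Q) := by rw [transpose_mul, hP.symm_left, hQ.symm_left]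
      _ = M * Q := by rw [← Matrix.mul_assoc, hP.mul_mul_left]
  have h2 : P * M = Q * M := by
    calc P * M = (P * M)ᵀ := hP.symm_right.symm
      _ = ((P * M) * (Q * M))ᵀ := by
        rw [Matrix.mul_assoc P, ← Matrix.mul_assoc M, hQ.mul_mul_left]
      _ = (Q * M) * (P * M) := by rw [transpose_mul, hP.symm_right, hQ.symm_right]
      _ = Q * M := by rw [Matrix.mul_assoc Q, ← Matrix.mul_assoc M, hP.mul_mul_left]
  calc P = P * M * P := hP.mul_mul_right.symm
    _ = Q * M * P := by rw [h2]
    _ = Q * (M * Q) := by rw [Matrix.mul_assoc, h1]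
    _ = Q := by rw [← Matrix.mul_assoc, hQ.mul_mul_right]

/-- The Moore-Penrose pseudoinverse. -/
noncomputable def pinv {k l : Type*} [Fintype k] [Fintype l]
    (M : Matrix k l ℝ) : Matrix l k ℝ :=
  Classical.choose (exists_isMoorePenrose M)

theorem pinv_isMoorePenrose {k l : Type*} [Fintype k] [Fintype l]
    (M : Matrix k l ℝ) : IsMoorePenrose M (pinv M) :=
  Classical.choose_spec (exists_isMoorePenrose M)

/-! ### Semidefinite programs -/

/-- Data of the semidefinite program
`min { tr (C X) : tr (A ℓ X) = b ℓ for all ℓ, X ⪰ 0 }`. -/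
structure SDP (n m : ℕ) where
  C : Matrix (Fin n) (Fin n) ℝ
  A : Fin m → Matrix (Fin n) (Fin n) ℝ
  b : Fin m → ℝ

namespace SDP

variable {n m : ℕ}

/-- A positive SDP: the cost matrix is (symmetric) positive definite and the
constraint matrices are symmetric. -/
structure IsPositive (P : SDP n m) : Prop where
  posDef_C : P.C.PosDef
  symm_A : ∀ ℓ, (P.A ℓ).IsSymm

/-- The `m × n²` matrix whose rows are the vectorized constraint matrices. -/
def constraintMatrix (P : SDP n m) : Matrix (Fin m) (Fin n × Fin n) ℝ :=
  Matrix.of fun ℓ => vec (P.A ℓ)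

def LinearlyFeasible (P : SDP n m) (X : Matrix (Fin n) (Fin n) ℝ) : Prop :=
  P.constraintMatrix *ᵥ vec X = P.b

def Feasible (P : SDP n m) (X : Matrix (Fin n) (Fin n) ℝ) : Prop :=
  P.LinearlyFeasible X ∧ X.PosSemidef

/-- Feasible and positive definite. -/
def StrictlyFeasible (P : SDP n m) (X : Matrix (Fin n) (Fin n) ℝ) : Prop :=
  P.LinearlyFeasible X ∧ X.PosDef

/-- `X` is an optimal solution of the SDP. -/
def IsOptimal (P : SDP n m) (X : Matrix (Fin n) (Fin n) ℝ) : Prop :=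
  P.Feasible X ∧ ∀ Y, P.Feasible Y → (P.C * X).trace ≤ (P.C * Y).trace

/-- Objective of the central path problem at parameter `t` with base point `F`. -/
noncomputable def centralObjective (P : SDP n m) (F : Matrix (Fin n) (Fin n) ℝ) (t : ℝ)
    (X : Matrix (Fin n) (Fin n) ℝ) : ℝ :=
  t * (P.C * X).trace - Real.log X.det + (F⁻¹ * X).trace

/-- `X` minimizes the central path objective over the strictly feasible matrices. -/
def IsCentralPoint (P : SDP n m) (F : Matrix (Fin n) (Fin n) ℝ) (t : ℝ)
    (X : Matrix (Fin n) (Fin n) ℝ) : Prop :=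
  P.StrictlyFeasible X ∧
    ∀ Y, P.StrictlyFeasible Y → P.centralObjective F t X ≤ P.centralObjective F t Y

/-- Right-hand side `-(I - G 𝒜ᵀ (𝒜 G 𝒜ᵀ)† 𝒜) G vec C` of the SDP Physarum dynamic with
conductance matrix `G`. -/
noncomputable def physarumField (P : SDP n m)
    (G : Matrix (Fin n × Fin n) (Fin n × Fin n) ℝ) : Fin n × Fin n → ℝ :=
  -((1 - G * P.constraintMatrixᵀ *
      pinv (P.constraintMatrix * G * P.constraintMatrixᵀ) * P.constraintMatrix) *ᵥ
    (G *ᵥ vec P.C))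

/-- `X` solves the second-ansatz dynamic (conductance `G = X ⊗ X`) on the time set `J`;
derivatives are taken within `J`, hence one-sided at an end point of `J`. -/
def SolvesSecondAnsatz (P : SDP n m) (J : Set ℝ)
    (X : ℝ → Matrix (Fin n) (Fin n) ℝ) : Prop :=
  ∀ t ∈ J, HasDerivWithinAt (fun s => vec (X s)) (P.physarumField (X t ⊗ₖ X t)) J t

end SDP

/-!
# The second-ansatz Physarum dynamic follows a central path

Call `V` tangent if it is symmetric and preserves the linear constraints. By concavity of `log det`
(`Matrix.PosDef.log_det_sub_log_det_le`), a strictly feasible `X` minimizes the central objective at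
parameter `t` if and only if `t C + F⁻¹ - X⁻¹` is orthogonal to all tangent directions
(`SDP.IsCritical`). The difference of two such conditions, for `X` at `t` and `Y` at `s`, says that
`(s - t) C + X⁻¹ (Y - X) Y⁻¹` is orthogonal to all tangent `V`, and the form `E ↦ tr (X⁻¹ E Y⁻¹ E)`
is bounded below by a multiple of `tr (E²)` as long as `X` and `Y` stay bounded
(`Matrix.mul_trace_mul_self_le`). With `V = Y - X` this gives uniqueness of the minimizer and
continuity of the path; with `V` the difference between the difference quotient and the Physarum
velocity it gives the differential equation, since the velocity is the tangent solution of the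
differentiated condition (`SDP.IsPositive.trace_add_inv_velocity`). Neither the implicit function
theorem nor smoothness of the vector field is used. Conversely, along any solution of the dynamic
the critical point condition is conserved as long as the solution is positive definite, and a
continuation argument shows that the solution never leaves the central path
(`SDP.SolvesSecondAnsatz.eqOn`).

For the limit `t → ∞`, the critical point condition bounds the path and shows that every limit point
is optimal; the difficulty, in the absence of strict complementarity, is that the path has a limit
at all. The reason is that the path is algebraic in `t`. If an entry `x` of it oscillated across an
interval, every nonzero bivariate `p` would be nonzero at `(t, x t)` for arbitrarily large `t`,
hence along a single ultrafilter `u` finer than `atTop` (`exists_ultrafilter_evalEval_ne_zero`): the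
germ of `x` would be transcendental over `ℝ(t)` in the field of germs of functions along `u`. On the
other hand, in this field the path solves a nondegenerate polynomial system over `ℝ(t)`, so every
derivation over `ℝ(t)` of the field generated by the entries of `X` and `X⁻¹` vanishes. That field
is therefore unramified over `ℝ(t)`, hence algebraic (`isAlgebraic_apply_of_anisotropic`,
`exists_evalEval_eventually_eq_zero`).
-/

/-! ### Positive definite real matrices -/

namespace Matrix

variable {ι : Type*}

theorem PosSemidef.isSymm {X : Matrix ι ι ℝ} (hX : X.PosSemidef) : X.IsSymm := by
  have h := hX.isHermitian
  rwa [IsHermitian, conjTranspose_eq_transpose_of_trivial] at h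

theorem PosDef.isSymm {X : Matrix ι ι ℝ} (hX : X.PosDef) : X.IsSymm :=
  hX.posSemidef.isSymm

theorem isHermitian_of_isSymm {X : Matrix ι ι ℝ} (hX : X.IsSymm) : X.IsHermitian := by
  rwa [IsHermitian, conjTranspose_eq_transpose_of_trivial]

theorem isSymm_of_sum_smul {κ : Type*} [Fintype κ] {A : κ → Matrix ι ι ℝ}
    (hA : ∀ k, (A k).IsSymm) (y : κ → ℝ) : (∑ k, y k • A k).IsSymm := by
  simp only [IsSymm, transpose_sum, transpose_smul]
  exact Finset.sum_congr rfl fun k _ => by rw [(hA k).eq]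

variable [Fintype ι]

open scoped MatrixOrder in
theorem PosSemidef.exists_eq_transpose_mul_self {P : Matrix ι ι ℝ} (hP : P.PosSemidef) :
    ∃ B : Matrix ι ι ℝ, P = Bᵀ * B := by
  classical
  obtain ⟨B, hB⟩ := CStarAlgebra.nonneg_iff_eq_star_mul_self.mp hP.nonneg
  exact ⟨B, by rw [hB, star_eq_conjTranspose, conjTranspose_eq_transpose_of_trivial]⟩

theorem PosSemidef.mul_mul_same_of_isSymm {P B : Matrix ι ι ℝ} (hP : P.PosSemidef)
    (hB : B.IsSymm) : (B * P * B).PosSemidef := by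
  have h := hP.mul_mul_conjTranspose_same B
  rwa [conjTranspose_eq_transpose_of_trivial, hB.eq] at h

theorem PosSemidef.trace_mul_nonneg {P Q : Matrix ι ι ℝ} (hP : P.PosSemidef)
    (hQ : Q.PosSemidef) : 0 ≤ (P * Q).trace := by
  obtain ⟨B, rfl⟩ := hP.exists_eq_transpose_mul_self
  have h := (hQ.mul_mul_conjTranspose_same B).trace_nonneg
  rwa [conjTranspose_eq_transpose_of_trivial, Matrix.trace_mul_comm, ← Matrix.mul_assoc] at h

theorem IsSymm.trace_mul_self {E : Matrix ι ι ℝ} (hE : E.IsSymm) :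
    (E * E).trace = ∑ i, ∑ j, E i j ^ 2 := by
  simp only [trace, diag, mul_apply]
  refine Finset.sum_congr rfl fun i _ => Finset.sum_congr rfl fun j _ => ?_
  rw [hE.apply i j, sq]

theorem IsSymm.sq_le_trace_mul_self {E : Matrix ι ι ℝ} (hE : E.IsSymm) (i j : ι) :
    E i j ^ 2 ≤ (E * E).trace := by
  rw [hE.trace_mul_self]
  exact (Finset.single_le_sum (f := fun j => E i j ^ 2) (fun j _ => sq_nonneg _)
      (Finset.mem_univ j)).trans
    (Finset.single_le_sum (f := fun i => ∑ j, E i j ^ 2)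
      (fun i _ => Finset.sum_nonneg fun j _ => sq_nonneg _) (Finset.mem_univ i))

variable [DecidableEq ι]

/-- Quantitative positivity of the Hessian `E ↦ P E Q` of `-log det`. -/
theorem mul_trace_mul_self_le {P Q E : Matrix ι ι ℝ} {p q : ℝ} (hp : 0 ≤ p)
    (hE : E.IsSymm) (hP : (P - p • 1).PosSemidef) (hQ : (Q - q • 1).PosSemidef)
    (hQ0 : Q.PosSemidef) :
    p * q * (E * E).trace ≤ (P * E * Q * E).trace := by
  have h1 := hP.trace_mul_nonneg (hQ0.mul_mul_same_of_isSymm hE)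
  have hEE : (E * E).PosSemidef := by
    simpa using (PosSemidef.one (n := ι) (R := ℝ)).mul_mul_same_of_isSymm hE
  have h2 := hQ.trace_mul_nonneg hEE
  rw [Matrix.sub_mul, trace_sub, sub_nonneg, smul_mul_assoc, trace_smul, Matrix.one_mul,
    smul_eq_mul] at h1 h2
  have h3 : (E * Q * E).trace = (Q * (E * E)).trace := by
    rw [Matrix.mul_assoc, Matrix.trace_mul_comm, Matrix.mul_assoc]
  have h4 : P * E * Q * E = P * (E * Q * E) := by simp only [Matrix.mul_assoc]
  rw [h4]
  rw [h3] at h1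
  nlinarith [mul_le_mul_of_nonneg_left h2 hp]

/-- A symmetric matrix with entries at most `δ` in absolute value is at most `|ι| δ`. -/
theorem IsSymm.posSemidef_smul_one_sub {E : Matrix ι ι ℝ} (hE : E.IsSymm) {δ : ℝ}
    (h : ∀ i j, |E i j| ≤ δ) : ((Fintype.card ι * δ) • 1 - E).PosSemidef := by
  refine PosSemidef.of_dotProduct_mulVec_nonneg
    (isHermitian_of_isSymm (by
      simp only [IsSymm, transpose_sub, transpose_smul, transpose_one, hE.eq])) fun v => ?_
  have hv : star v ⬝ᵥ (((Fintype.card ι * δ) • (1 : Matrix ι ι ℝ) - E) *ᵥ v)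
      = ∑ i, ∑ j, ((δ * v i ^ 2 + δ * v j ^ 2) / 2 - E i j * v i * v j) := by
    rw [sub_mulVec, smul_mulVec, one_mulVec, dotProduct_sub, dotProduct_smul, star_trivial]
    simp only [Finset.sum_sub_distrib, ← Finset.sum_div, Finset.sum_add_distrib,
      Finset.sum_const, Finset.card_univ, nsmul_eq_mul, smul_eq_mul, dotProduct, mulVec,
      ← Finset.mul_sum, add_div, mul_div_assoc]
    congr 1
    · simp only [← sq]
      ring
    · refine Finset.sum_congr rfl fun i _ => ?_
      rw [Finset.mul_sum]
      exact Finset.sum_congr rfl fun j _ => by ring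
  rw [hv]
  refine Finset.sum_nonneg fun i _ => Finset.sum_nonneg fun j _ => ?_
  have h1 := abs_le.mp (h i j)
  nlinarith [mul_nonneg (by linarith : 0 ≤ δ - E i j) (sq_nonneg (v i + v j)),
    mul_nonneg (by linarith : 0 ≤ δ + E i j) (sq_nonneg (v i - v j))]

theorem PosSemidef.abs_apply_le_trace {X : Matrix ι ι ℝ} (hX : X.PosSemidef) (i j : ι) :
    |X i j| ≤ X.trace := by
  have hd : ∀ i, 0 ≤ X i i := fun i => hX.diag_nonneg
  have hle : ∀ i, X i i ≤ X.trace := fun i =>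
    Finset.single_le_sum (f := fun i => X i i) (fun i _ => hd i) (Finset.mem_univ i)
  have hji : X j i = X i j := hX.isSymm.apply i j
  have key : ∀ s : ℝ, 0 ≤ X i i + s * X i j + s * (X i j + s * X j j) := fun s => by
    have h := hX.dotProduct_mulVec_nonneg (Pi.single i 1 + s • Pi.single j 1)
    simpa [mulVec_add, mulVec_smul, add_dotProduct, smul_dotProduct, hji, mul_add,
      add_mul] using h
  have h1 := key 1
  have h2 := key (-1)
  rw [abs_le]
  constructor <;> linarith [hle i, hle j]

theorem PosSemidef.posSemidef_trace_smul_one_sub {X : Matrix ι ι ℝ} (hX : X.PosSemidef) :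
    ((Fintype.card ι * X.trace) • 1 - X).PosSemidef :=
  hX.isSymm.posSemidef_smul_one_sub hX.abs_apply_le_trace

/-- An upper bound `X ≤ R` gives the lower bound `R⁻¹ ≤ X⁻¹`. -/
theorem PosDef.posSemidef_inv_sub {X : Matrix ι ι ℝ} (hX : X.PosDef) {R : ℝ} (hR : 0 < R)
    (h : (R • 1 - X).PosSemidef) : (X⁻¹ - R⁻¹ • 1).PosSemidef := by
  have hu : IsUnit X.det := (isUnit_iff_isUnit_det X).mp hX.isUnit
  -- completing the square: `X⁻¹ - r = (X⁻¹ - r) X (X⁻¹ - r) + r² (R - X)` for `r = R⁻¹`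
  have key : X⁻¹ - R⁻¹ • 1 = (X⁻¹ - R⁻¹ • 1) * X * (X⁻¹ - R⁻¹ • 1)
      + (R⁻¹ ^ 2) • (R • 1 - X) := by
    simp only [Matrix.sub_mul, Matrix.mul_sub, nonsing_inv_mul _ hu, mul_nonsing_inv _ hu,
      smul_mul_assoc, mul_smul_comm, Matrix.one_mul, Matrix.mul_one, smul_sub, smul_smul]
    have : R⁻¹ ^ 2 * R = R⁻¹ := by field_simp
    rw [this, ← sq]
    abel
  rw [key]
  have hs : (X⁻¹ - R⁻¹ • 1).IsSymm := by
    simp only [IsSymm, transpose_sub, transpose_smul, transpose_one, hX.inv.isSymm.eq]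
  exact (hX.posSemidef.mul_mul_same_of_isSymm hs).add (h.smul (sq_nonneg _))

theorem PosDef.exists_pos_posSemidef_sub {X : Matrix ι ι ℝ} (hX : X.PosDef) :
    ∃ c : ℝ, 0 < c ∧ (X - c • 1).PosSemidef := by
  set R : ℝ := Fintype.card ι * X⁻¹.trace + 1 with hRdef
  have hR : 0 < R := by
    have := hX.inv.posSemidef.trace_nonneg
    positivity
  refine ⟨R⁻¹, inv_pos.mpr hR, ?_⟩
  have hu : IsUnit X.det := (isUnit_iff_isUnit_det X).mp hX.isUnit
  have h : (R • 1 - X⁻¹).PosSemidef := by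
    have h1 := hX.inv.posSemidef.posSemidef_trace_smul_one_sub.add (PosSemidef.one (n := ι))
    convert h1 using 1
    rw [hRdef, add_smul, one_smul]
    abel
  simpa [nonsing_inv_nonsing_inv _ hu] using hX.inv.posSemidef_inv_sub hR h

/-- The positive definite matrices are open among the symmetric ones. -/
theorem PosDef.eventually_nhds {X : Matrix ι ι ℝ} (hX : X.PosDef) :
    ∀ᶠ Y in 𝓝 X, Y.IsSymm → Y.PosDef := by
  obtain ⟨c, hc, hXc⟩ := hX.exists_pos_posSemidef_sub
  set δ : ℝ := c / (Fintype.card ι + 1) with hδ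
  have hδ0 : 0 < δ := by positivity
  have hcδ : Fintype.card ι * δ < c := by
    rw [hδ, mul_div_assoc', div_lt_iff₀ (by positivity)]
    nlinarith
  have hev : ∀ᶠ Y in 𝓝 X, ∀ i j, |(X - Y) i j| ≤ δ := by
    refine eventually_all.mpr fun i => eventually_all.mpr fun j => ?_
    have hcont : Tendsto (fun Y : Matrix ι ι ℝ => |(X - Y) i j|) (𝓝 X) (𝓝 |(X - X) i j|) := by
      apply Continuous.tendsto
      simp only [sub_apply]
      fun_prop
    rw [sub_self, zero_apply, abs_zero] at hcont
    exact (hcont.eventually (gt_mem_nhds hδ0)).mono fun _ h => h.le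
  filter_upwards [hev] with Y hY hYs
  have h1 : (X - Y).IsSymm := hX.isSymm.sub hYs
  have h2 := (h1.posSemidef_smul_one_sub hY).add hXc
  have h3 := ((PosDef.one (n := ι) (R := ℝ)).smul (sub_pos.mpr hcδ)).add_posSemidef h2
  convert h3 using 1
  rw [sub_smul]
  abel

/-- `log det` lies below its tangent hyperplanes on the positive definite cone. -/
theorem PosDef.log_det_sub_log_det_le {X Y : Matrix ι ι ℝ} (hX : X.PosDef) (hY : Y.PosDef) :
    Real.log Y.det - Real.log X.det ≤ (X⁻¹ * (Y - X)).trace := by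
  have hu : IsUnit X.det := (isUnit_iff_isUnit_det X).mp hX.isUnit
  obtain ⟨B, hB⟩ := hX.inv.posSemidef.exists_eq_transpose_mul_self
  have hdet : B.det * B.det * X.det = 1 := by
    have h := congrArg det hB
    rw [det_mul, det_transpose] at h
    rw [← h, ← det_mul, nonsing_inv_mul _ hu, det_one]
  have hM0 : (B * Y * Bᵀ).PosSemidef := by
    simpa [conjTranspose_eq_transpose_of_trivial] using
      hY.posSemidef.mul_mul_conjTranspose_same B
  have hMdet : (B * Y * Bᵀ).det = Y.det / X.det := by
    rw [eq_div_iff hX.det_pos.ne', det_mul, det_mul, det_transpose]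
    linear_combination Y.det * hdet
  have hM : (B * Y * Bᵀ).PosDef :=
    hM0.posDef_iff_det_ne_zero.mpr (by
      rw [hMdet]; exact (div_pos hY.det_pos hX.det_pos).ne')
  have htr : (B * Y * Bᵀ).trace = (X⁻¹ * Y).trace := by
    rw [Matrix.trace_mul_comm, ← Matrix.mul_assoc, ← hB]
  have hlog : Real.log (B * Y * Bᵀ).det ≤ (B * Y * Bᵀ).trace - Fintype.card ι := by
    rw [hM.isHermitian.det_eq_prod_eigenvalues, hM.isHermitian.trace_eq_sum_eigenvalues]
    simp only [RCLike.ofReal_real_eq_id, id]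
    rw [Real.log_prod (fun i _ => (hM.eigenvalues_pos i).ne')]
    calc ∑ i, Real.log (hM.isHermitian.eigenvalues i)
        ≤ ∑ i, (hM.isHermitian.eigenvalues i - 1) :=
          Finset.sum_le_sum fun i _ => Real.log_le_sub_one_of_pos (hM.eigenvalues_pos i)
      _ = _ := by simp
  rw [hMdet, Real.log_div hY.det_pos.ne' hX.det_pos.ne', htr] at hlog
  rw [Matrix.mul_sub, trace_sub, nonsing_inv_mul _ hu, trace_one]
  exact hlog

theorem tendsto_inv_of_isUnit {α : Type*} {l : Filter α} {f : α → Matrix ι ι ℝ}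
    {X : Matrix ι ι ℝ} (hf : Tendsto f l (𝓝 X)) (hX : X.det ≠ 0) :
    Tendsto (fun a => (f a)⁻¹) l (𝓝 X⁻¹) := by
  have h1 : Tendsto (fun a => (f a).det) l (𝓝 X.det) :=
    (continuous_id.matrix_det.tendsto X).comp hf
  have h2 : Tendsto (fun a => (f a).adjugate) l (𝓝 X.adjugate) :=
    (continuous_id.matrix_adjugate.tendsto X).comp hf
  simp only [inv_def, Ring.inverse_eq_inv']
  exact (h1.inv₀ hX).smul h2

end Matrix

/-! ### Linear constraints and feasible directions -/

/-- For `G` positive definite, `B G Bᵀ` has the same range as `B`, and `M M†` is the orthogonal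
projection onto the range of `M`. -/
theorem mul_pinv_mul_of_posDef {k l : Type*} [Fintype k] [Fintype l]
    (B : Matrix k l ℝ) {G : Matrix l l ℝ} (hG : G.PosDef) :
    B * G * Bᵀ * pinv (B * G * Bᵀ) * B = B := by
  classical
  set M := B * G * Bᵀ with hM
  have hp := pinv_isMoorePenrose M
  set R := 1 - M * pinv M with hR
  have hRt : Rᵀ = R := by rw [hR, transpose_sub, transpose_one, hp.symm_left]
  have hRM : R * M = 0 := by rw [hR, Matrix.sub_mul, Matrix.one_mul, hp.mul_mul_left, sub_self]
  have hRB : R * B = 0 := by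
    have h0 : R * B * G * (R * B)ᵀ = 0 := by
      rw [transpose_mul, hRt]
      calc R * B * G * (Bᵀ * R) = R * M * R := by simp only [hM, Matrix.mul_assoc]
        _ = 0 := by rw [hRM, Matrix.zero_mul]
    ext i j
    by_contra hne
    have hv : (R * B) i ≠ 0 := fun h => hne (by rw [h]; rfl)
    have hpos := hG.dotProduct_mulVec_pos hv
    have h1 : (R * B * G * (R * B)ᵀ) i i = star ((R * B) i) ⬝ᵥ (G *ᵥ (R * B) i) := by
      rw [Matrix.mul_assoc, Matrix.mul_apply, star_trivial]
      rfl
    rw [← h1, h0, Matrix.zero_apply] at hpos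
    exact lt_irrefl _ hpos
  rw [hR, Matrix.sub_mul, Matrix.one_mul, sub_eq_zero] at hRB
  exact hRB.symm

namespace SDP

variable {n m : ℕ} {P : SDP n m}

/-- The symmetric directions along which the linear constraints are preserved. -/
structure IsTangent (P : SDP n m) (V : Matrix (Fin n) (Fin n) ℝ) : Prop where
  isSymm : V.IsSymm
  mulVec_vec : P.constraintMatrix *ᵥ vec V = 0

/-- The linear combination `∑ y_ℓ A_ℓ` of the constraint matrices. -/
def combination (P : SDP n m) (y : Fin m → ℝ) : Matrix (Fin n) (Fin n) ℝ :=
  ∑ ℓ, y ℓ • P.A ℓ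

theorem vec_combination (y : Fin m → ℝ) :
    vec (P.combination y) = P.constraintMatrixᵀ *ᵥ y := by
  ext ⟨i, j⟩
  simp [combination, constraintMatrix, mulVec, dotProduct, vec, Matrix.sum_apply, mul_comm]

theorem IsPositive.isSymm_combination (hP : P.IsPositive) (y : Fin m → ℝ) :
    (P.combination y).IsSymm :=
  isSymm_of_sum_smul hP.symm_A y

theorem IsPositive.trace_combination_mul (hP : P.IsPositive) (y : Fin m → ℝ)
    {V : Matrix (Fin n) (Fin n) ℝ} (hV : P.constraintMatrix *ᵥ vec V = 0) :
    (P.combination y * V).trace = 0 := by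
  have h := vec_dotProduct_vec (P.combination y) V
  rw [(hP.isSymm_combination y).eq, vec_combination, mulVec_transpose,
    ← dotProduct_mulVec, hV, dotProduct_zero] at h
  exact h.symm

theorem IsTangent.neg {V : Matrix (Fin n) (Fin n) ℝ} (hV : P.IsTangent V) :
    P.IsTangent (-V) :=
  ⟨by simp [IsSymm, hV.isSymm.eq], by rw [vec_neg, mulVec_neg, hV.mulVec_vec, neg_zero]⟩

theorem IsTangent.sub {V W : Matrix (Fin n) (Fin n) ℝ} (hV : P.IsTangent V)
    (hW : P.IsTangent W) : P.IsTangent (V - W) :=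
  ⟨hV.isSymm.sub hW.isSymm,
    by rw [vec_sub, mulVec_sub, hV.mulVec_vec, hW.mulVec_vec, sub_zero]⟩

theorem IsTangent.smul {V : Matrix (Fin n) (Fin n) ℝ} (hV : P.IsTangent V) (r : ℝ) :
    P.IsTangent (r • V) :=
  ⟨by simp [IsSymm, hV.isSymm.eq], by rw [vec_smul, mulVec_smul, hV.mulVec_vec, smul_zero]⟩

theorem LinearlyFeasible.isTangent_sub {X Y : Matrix (Fin n) (Fin n) ℝ}
    (hX : P.LinearlyFeasible X) (hY : P.LinearlyFeasible Y) (hXs : X.IsSymm) (hYs : Y.IsSymm) :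
    P.IsTangent (X - Y) :=
  ⟨hXs.sub hYs, by rw [vec_sub, mulVec_sub, hX, hY, sub_self]⟩

theorem StrictlyFeasible.isTangent_sub {X Y : Matrix (Fin n) (Fin n) ℝ}
    (hX : P.StrictlyFeasible X) (hY : P.StrictlyFeasible Y) : P.IsTangent (X - Y) :=
  hX.1.isTangent_sub hY.1 hX.2.isSymm hY.2.isSymm

theorem LinearlyFeasible.add_isTangent {X V : Matrix (Fin n) (Fin n) ℝ}
    (hX : P.LinearlyFeasible X) (hV : P.IsTangent V) : P.LinearlyFeasible (X + V) := by
  rw [LinearlyFeasible, vec_add, mulVec_add, hV.mulVec_vec, add_zero, hX]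

theorem isClosed_setOf_linearlyFeasible : IsClosed {X | P.LinearlyFeasible X} := by
  refine isClosed_eq ?_ continuous_const
  refine Continuous.matrix_mulVec continuous_const (continuous_pi fun ij => ?_)
  exact continuous_apply_apply ij.2 ij.1

/-! ### The optimality condition of the central path problem -/

/-- The first order condition: the gradient `t C + F⁻¹ - X⁻¹` of the objective is orthogonal to
the feasible directions. -/
def IsCritical (P : SDP n m) (F : Matrix (Fin n) (Fin n) ℝ) (t : ℝ)
    (X : Matrix (Fin n) (Fin n) ℝ) : Prop :=
  ∀ V, P.IsTangent V → ((t • P.C + F⁻¹ - X⁻¹) * V).trace = 0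

variable {F X Y : Matrix (Fin n) (Fin n) ℝ} {t : ℝ}

theorem centralObjective_eq :
    P.centralObjective F t X = ((t • P.C + F⁻¹) * X).trace - Real.log X.det := by
  rw [centralObjective, Matrix.add_mul, trace_add, smul_mul_assoc, trace_smul, smul_eq_mul]
  ring

theorem IsCritical.isCentralPoint (hX : P.StrictlyFeasible X) (h : P.IsCritical F t X) :
    P.IsCentralPoint F t X := by
  refine ⟨hX, fun Y hY => ?_⟩
  have h1 := hX.2.log_det_sub_log_det_le hY.2
  have h2 := h _ (hY.isTangent_sub hX)
  rw [Matrix.sub_mul, trace_sub, Matrix.mul_sub (t • P.C + F⁻¹), trace_sub] at h2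
  rw [centralObjective_eq, centralObjective_eq]
  linarith

/-- Moving along a tangent `V` from `X` to `X + ε V`, the tangent inequality for `log det` at
`X + ε V` bounds the increase of the objective by `ε tr ((t C + F⁻¹ - (X + ε V)⁻¹) V)`. -/
theorem IsCentralPoint.isCritical (h : P.IsCentralPoint F t X) : P.IsCritical F t X := by
  have key : ∀ V, P.IsTangent V → 0 ≤ ((t • P.C + F⁻¹ - X⁻¹) * V).trace := by
    intro V hV
    have hlim : Tendsto (fun ε : ℝ => X + ε • V) (𝓝[>] 0) (𝓝 X) := by
      have : Tendsto (fun ε : ℝ => X + ε • V) (𝓝 0) (𝓝 (X + (0 : ℝ) • V)) :=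
        Continuous.tendsto (by fun_prop) 0
      rw [zero_smul, add_zero] at this
      exact this.mono_left nhdsWithin_le_nhds
    have hlim2 : Tendsto (fun ε : ℝ => ((t • P.C + F⁻¹ - (X + ε • V)⁻¹) * V).trace) (𝓝[>] 0)
        (𝓝 ((t • P.C + F⁻¹ - X⁻¹) * V).trace) := by
      have hc : Continuous fun Z : Matrix (Fin n) (Fin n) ℝ =>
          ((t • P.C + F⁻¹ - Z) * V).trace := by fun_prop
      exact (hc.tendsto _).comp (tendsto_inv_of_isUnit hlim h.1.2.det_pos.ne')
    refine ge_of_tendsto hlim2 ?_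
    filter_upwards [hlim.eventually h.1.2.eventually_nhds, self_mem_nhdsWithin] with ε hε hpos
    have hpd := hε (h.1.2.isSymm.add (hV.smul ε).isSymm)
    have hmin := h.2 _ ⟨h.1.1.add_isTangent (hV.smul ε), hpd⟩
    have hlog := hpd.log_det_sub_log_det_le h.1.2
    rw [centralObjective_eq, centralObjective_eq, Matrix.mul_add, trace_add] at hmin
    rw [sub_add_cancel_left, mul_neg, trace_neg, mul_smul_comm, trace_smul, smul_eq_mul] at hlog
    rw [mul_smul_comm, trace_smul, smul_eq_mul] at hmin
    have hprod : 0 ≤ ε * ((t • P.C + F⁻¹ - (X + ε • V)⁻¹) * V).trace := by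
      rw [Matrix.sub_mul, trace_sub, mul_sub]
      linarith
    exact nonneg_of_mul_nonneg_right hprod hpos
  intro V hV
  have h1 := key V hV
  have h2 := key (-V) hV.neg
  rw [mul_neg, trace_neg] at h2
  linarith

theorem inv_sub_inv_eq (hX : X.PosDef) (hY : Y.PosDef) : X⁻¹ - Y⁻¹ = X⁻¹ * (Y - X) * Y⁻¹ := by
  have huX : IsUnit X.det := (isUnit_iff_isUnit_det X).mp hX.isUnit
  have huY : IsUnit Y.det := (isUnit_iff_isUnit_det Y).mp hY.isUnit
  rw [Matrix.mul_sub, Matrix.sub_mul, Matrix.mul_assoc, mul_nonsing_inv _ huY,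
    nonsing_inv_mul _ huX, Matrix.mul_one, Matrix.one_mul]

/-- The difference of the first order conditions at two parameters. -/
theorem IsCritical.trace_add_eq_zero {s : ℝ} (hX : X.PosDef) (hY : Y.PosDef)
    (hXc : P.IsCritical F t X) (hYc : P.IsCritical F s Y) {V : Matrix (Fin n) (Fin n) ℝ}
    (hV : P.IsTangent V) :
    (s - t) * (P.C * V).trace + (X⁻¹ * (Y - X) * Y⁻¹ * V).trace = 0 := by
  have h1 := hXc V hV
  have h2 := hYc V hV
  rw [← inv_sub_inv_eq hX hY]
  simp only [Matrix.sub_mul, Matrix.add_mul, trace_sub, trace_add, smul_mul_assoc, trace_smul,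
    smul_eq_mul] at h1 h2 ⊢
  linarith

theorem IsCentralPoint.unique (hX : P.IsCentralPoint F t X) (hY : P.IsCentralPoint F t Y) :
    Y = X := by
  have hD := hY.1.isTangent_sub hX.1
  have h := IsCritical.trace_add_eq_zero hX.1.2 hY.1.2 hX.isCritical hY.isCritical hD
  rw [sub_self, zero_mul, zero_add] at h
  obtain ⟨p, hp, hpX⟩ := hX.1.2.inv.exists_pos_posSemidef_sub
  obtain ⟨q, hq, hqY⟩ := hY.1.2.inv.exists_pos_posSemidef_sub
  have h1 := mul_trace_mul_self_le hp.le hD.isSymm hpX hqY hY.1.2.inv.posSemidef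
  rw [h] at h1
  have h2 : ((Y - X) * (Y - X)).trace ≤ 0 := nonpos_of_mul_nonpos_right h1 (mul_pos hp hq)
  ext i j
  have h3 := (hD.isSymm.sq_le_trace_mul_self i j).trans h2
  have h4 : (Y - X) i j = 0 := by nlinarith
  exact sub_eq_zero.mp h4

theorem StrictlyFeasible.isCentralPoint_zero (hF : P.StrictlyFeasible F) :
    P.IsCentralPoint F 0 F :=
  IsCritical.isCentralPoint hF fun V _ => by simp

/-! ### Existence of central points -/

theorem isClosed_setOf_posSemidef :
    IsClosed {X : Matrix (Fin n) (Fin n) ℝ | X.PosSemidef} := by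
  have : {X : Matrix (Fin n) (Fin n) ℝ | X.PosSemidef}
      = {X | Xᵀ = X} ∩ ⋂ v : Fin n → ℝ, {X | 0 ≤ v ⬝ᵥ (X *ᵥ v)} := by
    ext X
    simp [posSemidef_iff_dotProduct_mulVec, IsHermitian,
      conjTranspose_eq_transpose_of_trivial]
  rw [this]
  refine (isClosed_eq continuous_id.matrix_transpose continuous_id).inter
    (isClosed_iInter fun v => isClosed_le continuous_const ?_)
  fun_prop

theorem isCompact_setOf_trace_le_det_ge (R δ : ℝ) :
    IsCompact {X | P.LinearlyFeasible X ∧ X.PosSemidef ∧ X.trace ≤ R ∧ δ ≤ X.det} := by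
  have hclosed : IsClosed {X | P.LinearlyFeasible X ∧ X.PosSemidef ∧ X.trace ≤ R ∧ δ ≤ X.det} :=
    isClosed_setOf_linearlyFeasible.inter (isClosed_setOf_posSemidef.inter
      ((isClosed_le continuous_id.matrix_trace continuous_const).inter
        (isClosed_le continuous_const continuous_id.matrix_det)))
  refine IsCompact.of_isClosed_subset (s := Set.pi Set.univ fun _ : Fin n =>
    Set.pi Set.univ fun _ : Fin n => Set.Icc (-R) R) ?_ hclosed ?_
  · exact isCompact_univ_pi fun _ => isCompact_univ_pi fun _ => isCompact_Icc
  · rintro X ⟨-, hX, hR, -⟩ i - j -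
    exact abs_le.mp ((hX.abs_apply_le_trace i j).trans hR)

theorem IsPositive.posDef_smul_add (hP : P.IsPositive) (hF : F.PosDef) (ht : 0 ≤ t) :
    (t • P.C + F⁻¹).PosDef :=
  PosDef.posSemidef_add (hP.posDef_C.posSemidef.smul ht) hF.inv

/-- Sublevel sets of the objective have bounded trace and determinant bounded away from zero, so they
lie in a compact set of positive definite matrices. -/
theorem exists_isCentralPoint (hP : P.IsPositive) (hF : P.StrictlyFeasible F) (ht : 0 ≤ t) :
    ∃ X, P.IsCentralPoint F t X := by
  set N := t • P.C + F⁻¹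
  have hNpd : N.PosDef := hP.posDef_smul_add hF.2 ht
  obtain ⟨c, hc, hNc⟩ := hNpd.exists_pos_posSemidef_sub
  set M := P.centralObjective F t F with hM
  -- half of the linear term dominates `log det` up to a constant
  set Z : Matrix (Fin n) (Fin n) ℝ := ((1 / 2 : ℝ) • N)⁻¹ with hZ
  have hZpd : Z.PosDef := (hNpd.smul (by norm_num : (0 : ℝ) < 1 / 2)).inv
  have hZinv : Z⁻¹ = (1 / 2 : ℝ) • N := by
    rw [hZ, nonsing_inv_nonsing_inv]
    exact (isUnit_iff_isUnit_det _).mp (hNpd.smul (by norm_num : (0 : ℝ) < 1 / 2)).isUnit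
  set a := Real.log Z.det - (Z⁻¹ * Z).trace
  have hlow : ∀ Y : Matrix (Fin n) (Fin n) ℝ, Y.PosDef →
      Real.log Y.det ≤ a + 1 / 2 * (N * Y).trace := by
    intro Y hY
    have h := hZpd.log_det_sub_log_det_le hY
    rw [Matrix.mul_sub, trace_sub] at h
    have h' : (Z⁻¹ * Y).trace = 1 / 2 * (N * Y).trace := by
      rw [hZinv, smul_mul_assoc, trace_smul, smul_eq_mul]
    rw [h'] at h
    linarith
  have htr : ∀ Y : Matrix (Fin n) (Fin n) ℝ, Y.PosDef → c * Y.trace ≤ (N * Y).trace := by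
    intro Y hY
    have h := hNc.trace_mul_nonneg hY.posSemidef
    rw [Matrix.sub_mul, trace_sub, smul_mul_assoc, trace_smul, Matrix.one_mul,
      smul_eq_mul] at h
    linarith
  set K := {X | P.LinearlyFeasible X ∧ X.PosSemidef ∧ X.trace ≤ (2 * (M + a)) / c ∧
    Real.exp (-M) ≤ X.det}
  have hsub : ∀ Y, P.StrictlyFeasible Y → P.centralObjective F t Y ≤ M → Y ∈ K := by
    intro Y hY hYM
    rw [centralObjective_eq] at hYM
    have h1 := hlow Y hY.2
    have h2 := htr Y hY.2
    refine ⟨hY.1, hY.2.posSemidef, ?_, ?_⟩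
    · rw [le_div_iff₀ hc]
      linarith
    · rw [← Real.le_log_iff_exp_le hY.2.det_pos]
      linarith [(hNpd.posSemidef).trace_mul_nonneg hY.2.posSemidef]
  have hKpd : ∀ Y ∈ K, P.StrictlyFeasible Y := fun Y hY =>
    ⟨hY.1, hY.2.1.posDef_iff_det_ne_zero.mpr ((Real.exp_pos _).trans_le hY.2.2.2).ne'⟩
  have hcont : ContinuousOn (P.centralObjective F t) K := by
    have h1 : Continuous fun X : Matrix (Fin n) (Fin n) ℝ => (N * X).trace := by fun_prop
    have h2 : ContinuousOn (fun X : Matrix (Fin n) (Fin n) ℝ => Real.log X.det) K :=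
      ContinuousOn.log continuous_id.matrix_det.continuousOn fun Y hY =>
        ((Real.exp_pos _).trans_le hY.2.2.2).ne'
    exact (h1.continuousOn.sub h2).congr fun X _ => centralObjective_eq
  obtain ⟨X, hXK, hXmin⟩ := (isCompact_setOf_trace_le_det_ge _ _).exists_isMinOn
    ⟨F, hsub F hF le_rfl⟩ hcont
  refine ⟨X, hKpd X hXK, fun Y hY => ?_⟩
  rcases le_total (P.centralObjective F t Y) M with h | h
  · exact hXmin (hsub Y hY h)
  · exact (hXmin (hsub F hF le_rfl)).trans h

end SDP

/-! ### The Physarum vector field -/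

namespace SDP

variable {n m : ℕ} {P : SDP n m}

/-- The right-hand side of the second-ansatz dynamic at `X`, as a matrix. -/
noncomputable def velocity (P : SDP n m) (X : Matrix (Fin n) (Fin n) ℝ) :
    Matrix (Fin n) (Fin n) ℝ :=
  Matrix.of fun i j => P.physarumField (X ⊗ₖ X) (j, i)

theorem vec_velocity (X : Matrix (Fin n) (Fin n) ℝ) :
    vec (P.velocity X) = P.physarumField (X ⊗ₖ X) := rfl

theorem exists_velocity_eq (X : Matrix (Fin n) (Fin n) ℝ) :
    ∃ y, P.velocity X = -(X * (P.C - P.combination y) * Xᵀ) := by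
  refine ⟨pinv (P.constraintMatrix * (X ⊗ₖ X) * P.constraintMatrixᵀ) *ᵥ
    (P.constraintMatrix *ᵥ ((X ⊗ₖ X) *ᵥ vec P.C)), vec_inj.mp ?_⟩
  rw [vec_velocity, physarumField, vec_neg, Matrix.mul_sub, Matrix.sub_mul, vec_sub,
    ← kronecker_mulVec_vec, ← kronecker_mulVec_vec, vec_combination, sub_mulVec, one_mulVec]
  simp only [mulVec_mulVec, Matrix.mul_assoc]

theorem IsPositive.isSymm_velocity (hP : P.IsPositive) (X : Matrix (Fin n) (Fin n) ℝ) :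
    (P.velocity X).IsSymm := by
  obtain ⟨y, hy⟩ := P.exists_velocity_eq X
  rw [hy, IsSymm, transpose_neg, transpose_mul, transpose_mul, transpose_transpose,
    transpose_sub, (hP.isSymm_combination y).eq, hP.posDef_C.isSymm.eq, Matrix.mul_assoc]

theorem IsPositive.isTangent_velocity (hP : P.IsPositive) {X : Matrix (Fin n) (Fin n) ℝ}
    (hX : X.PosDef) : P.IsTangent (P.velocity X) := by
  refine ⟨hP.isSymm_velocity X, ?_⟩
  have h := mul_pinv_mul_of_posDef P.constraintMatrix (hX.kronecker hX)
  rw [vec_velocity, physarumField, mulVec_neg, mulVec_mulVec, Matrix.mul_sub, Matrix.mul_one,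
    neg_eq_zero]
  have h2 : P.constraintMatrix * (X ⊗ₖ X * P.constraintMatrixᵀ *
      pinv (P.constraintMatrix * X ⊗ₖ X * P.constraintMatrixᵀ) * P.constraintMatrix)
      = P.constraintMatrix := by
    simpa only [Matrix.mul_assoc] using h
  rw [h2, sub_self, zero_mulVec]

/-- The velocity satisfies the differentiated first order condition. -/
theorem IsPositive.trace_add_inv_velocity (hP : P.IsPositive) {X : Matrix (Fin n) (Fin n) ℝ}
    (hX : X.PosDef) {V : Matrix (Fin n) (Fin n) ℝ} (hV : P.IsTangent V) :
    (P.C * V).trace + (X⁻¹ * P.velocity X * X⁻¹ * V).trace = 0 := by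
  obtain ⟨y, hy⟩ := P.exists_velocity_eq X
  have hu : IsUnit X.det := (isUnit_iff_isUnit_det X).mp hX.isUnit
  have h1 : X⁻¹ * P.velocity X * X⁻¹ = P.combination y - P.C := by
    rw [hy, hX.isSymm.eq, mul_neg, neg_mul, Matrix.mul_assoc X, ← Matrix.mul_assoc X⁻¹,
      nonsing_inv_mul _ hu, Matrix.one_mul, Matrix.mul_assoc, mul_nonsing_inv _ hu,
      Matrix.mul_one, neg_sub]
  rw [h1, Matrix.sub_mul, trace_sub, hP.trace_combination_mul y hV.mulVec_vec]
  ring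

/-! ### A priori bounds along the central path -/

variable {F X Y : Matrix (Fin n) (Fin n) ℝ} {s t : ℝ}

/-- The first order condition tested against `Y - X`, with `tr (X⁻¹ Y) ≥ 0` dropped. -/
theorem IsCentralPoint.smul_gap_le (hX : P.IsCentralPoint F t X) (hY : P.Feasible Y) :
    t * ((P.C * X).trace - (P.C * Y).trace) + (F⁻¹ * X).trace ≤ (F⁻¹ * Y).trace + n := by
  have h := hX.isCritical _ (hY.1.isTangent_sub hX.1.1 hY.2.isSymm hX.1.2.isSymm)
  have hu : IsUnit X.det := (isUnit_iff_isUnit_det X).mp hX.1.2.isUnit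
  have h1 := hX.1.2.inv.posSemidef.trace_mul_nonneg hY.2
  have h2 : (X⁻¹ * X).trace = n := by simp [nonsing_inv_mul _ hu]
  simp only [Matrix.sub_mul, Matrix.add_mul, Matrix.mul_sub, trace_sub, trace_add,
    smul_mul_assoc, trace_smul, smul_eq_mul] at h
  linarith

theorem StrictlyFeasible.feasible (hX : P.StrictlyFeasible X) : P.Feasible X :=
  ⟨hX.1, hX.2.posSemidef⟩

theorem StrictlyFeasible.trace_inv_mul_self (hF : P.StrictlyFeasible F) :
    (F⁻¹ * F).trace = n := by
  have hu : IsUnit F.det := (isUnit_iff_isUnit_det F).mp hF.2.isUnit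
  simp [nonsing_inv_mul _ hu]

theorem exists_trace_le (hP : P.IsPositive) (hF : P.StrictlyFeasible F) (T : ℝ) :
    ∃ R : ℝ, ∀ s X, 0 ≤ s → s ≤ T → P.IsCentralPoint F s X → X.trace ≤ R := by
  obtain ⟨c, hc, hcF⟩ := hF.2.inv.exists_pos_posSemidef_sub
  refine ⟨(T * (P.C * F).trace + 2 * n) / c, fun s X hs hsT hX => ?_⟩
  have h1 := hX.smul_gap_le hF.feasible
  rw [hF.trace_inv_mul_self] at h1
  have h2 := hcF.trace_mul_nonneg hX.1.2.posSemidef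
  rw [Matrix.sub_mul, trace_sub, smul_mul_assoc, trace_smul, Matrix.one_mul, smul_eq_mul] at h2
  have h3 := mul_nonneg hs (hP.posDef_C.posSemidef.trace_mul_nonneg hX.1.2.posSemidef)
  have h4 := mul_le_mul_of_nonneg_right hsT
    (hP.posDef_C.posSemidef.trace_mul_nonneg hF.2.posSemidef)
  rw [le_div_iff₀ hc]
  linarith

/-- Bounded central points have inverses bounded below. -/
theorem exists_posSemidef_inv_sub (hP : P.IsPositive) (hF : P.StrictlyFeasible F) (T : ℝ) :
    ∃ q : ℝ, 0 < q ∧ ∀ s X, 0 ≤ s → s ≤ T → P.IsCentralPoint F s X →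
      (X⁻¹ - q • 1).PosSemidef := by
  obtain ⟨R, hR⟩ := exists_trace_le hP hF T
  have hR' : 0 < n * |R| + 1 := by positivity
  refine ⟨(n * |R| + 1)⁻¹, inv_pos.mpr hR', fun s X hs hsT hX => ?_⟩
  refine hX.1.2.posSemidef_inv_sub hR' ?_
  have h1 := hX.1.2.posSemidef.posSemidef_trace_smul_one_sub
  have h2 : (0 : ℝ) ≤ n * |R| + 1 - n * X.trace := by
    have := mul_le_mul_of_nonneg_left ((hR s X hs hsT hX).trans (le_abs_self R))
      (Nat.cast_nonneg (α := ℝ) n)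
    linarith
  convert h1.add (PosSemidef.one.smul h2) using 1
  rw [Fintype.card_fin, sub_smul]
  abel

theorem tendsto_of_trace_mul_self_le {α : Type*} {l : Filter α}
    {f : α → Matrix (Fin n) (Fin n) ℝ} {g : α → ℝ} (hs : ∀ᶠ a in l, (f a - X).IsSymm)
    (hle : ∀ᶠ a in l, ((f a - X) * (f a - X)).trace ≤ g a) (hg : Tendsto g l (𝓝 0)) :
    Tendsto f l (𝓝 X) := by
  refine tendsto_pi_nhds.mpr fun i => tendsto_pi_nhds.mpr fun j => ?_
  rw [tendsto_iff_norm_sub_tendsto_zero]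
  have hsqrt : Tendsto (fun a => √(g a)) l (𝓝 0) := by
    simpa [Function.comp_def] using (Real.continuous_sqrt.tendsto 0).comp hg
  refine squeeze_zero' (Eventually.of_forall fun _ => norm_nonneg _) ?_ hsqrt
  filter_upwards [hs, hle] with a ha1 ha2
  exact Real.abs_le_sqrt ((ha1.sq_le_trace_mul_self i j).trans ha2)

/-- Testing the difference of two first order conditions against `X s - X t` gives
`‖X s - X t‖² = O(|s - t|)`. -/
theorem continuousOn_of_isCentralPoint (hP : P.IsPositive) (hF : P.StrictlyFeasible F)
    {X : ℝ → Matrix (Fin n) (Fin n) ℝ} (hX : ∀ t, 0 ≤ t → P.IsCentralPoint F t (X t)) :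
    ContinuousOn X (Set.Ici 0) := by
  intro t ht
  rw [Set.mem_Ici] at ht
  obtain ⟨R, hR⟩ := exists_trace_le hP hF (t + 1)
  obtain ⟨q, hq, hqX⟩ := exists_posSemidef_inv_sub hP hF (t + 1)
  have hC := hP.posDef_C.posSemidef
  set B : ℝ := n * P.C.trace * R
  have hCX : ∀ s, 0 ≤ s → s ≤ t + 1 → (P.C * X s).trace ≤ B := by
    intro s hs hsT
    have h1 := hC.posSemidef_trace_smul_one_sub.trace_mul_nonneg (hX s hs).1.2.posSemidef
    rw [Matrix.sub_mul, trace_sub, smul_mul_assoc, trace_smul, Matrix.one_mul, smul_eq_mul,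
      Fintype.card_fin] at h1
    have h2 := mul_le_mul_of_nonneg_left (hR s _ hs hsT (hX s hs))
      (mul_nonneg (Nat.cast_nonneg (α := ℝ) n) hC.trace_nonneg)
    linarith
  have hev : ∀ᶠ s in 𝓝[Set.Ici 0] t, 0 ≤ s ∧ s ≤ t + 1 :=
    inter_mem self_mem_nhdsWithin
      (mem_nhdsWithin_of_mem_nhds (Iic_mem_nhds (by linarith : t < t + 1)))
  refine tendsto_of_trace_mul_self_le (g := fun s => (q * q)⁻¹ * (|s - t| * B)) ?_ ?_ ?_
  · filter_upwards [hev] with s hs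
    exact ((hX s hs.1).1.isTangent_sub (hX t ht).1).isSymm
  · filter_upwards [hev] with s hs
    have hD := (hX s hs.1).1.isTangent_sub (hX t ht).1
    have h1 := IsCritical.trace_add_eq_zero (hX t ht).1.2 (hX s hs.1).1.2 (hX t ht).isCritical
      (hX s hs.1).isCritical hD
    have h2 := mul_trace_mul_self_le hq.le hD.isSymm (hqX t _ ht (by linarith) (hX t ht))
      (hqX s _ hs.1 hs.2 (hX s hs.1)) (hX s hs.1).1.2.inv.posSemidef
    have h3 : |(P.C * (X s - X t)).trace| ≤ B := by
      rw [Matrix.mul_sub, trace_sub, abs_le]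
      have a1 := hCX s hs.1 hs.2
      have a2 := hCX t ht (by linarith)
      have a3 := hC.trace_mul_nonneg (hX s hs.1).1.2.posSemidef
      have a4 := hC.trace_mul_nonneg (hX t ht).1.2.posSemidef
      constructor <;> linarith
    have h4 : -((s - t) * (P.C * (X s - X t)).trace) ≤ |s - t| * B := by
      refine (neg_le_abs _).trans ?_
      rw [abs_mul]
      exact mul_le_mul_of_nonneg_left h3 (abs_nonneg _)
    rw [le_inv_mul_iff₀ (mul_pos hq hq)]
    linarith
  · have hcont : Continuous fun s : ℝ => (q * q)⁻¹ * (|s - t| * B) := by fun_prop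
    have := (hcont.tendsto t).mono_left (nhdsWithin_le_nhds (s := Set.Ici 0))
    simpa using this

/-! ### The central path solves the dynamic -/

/-- From `c ‖E‖² ≤ ⟨Wᵀ, E⟩` to `c² ‖E‖² ≤ ‖W‖²`. -/
theorem sq_mul_trace_mul_self_le {ι : Type*} [Fintype ι] {E W : Matrix ι ι ℝ} {c : ℝ}
    (hc : 0 ≤ c) (hE : E.IsSymm) (h : c * (E * E).trace ≤ (W * E).trace) :
    c ^ 2 * (E * E).trace ≤ (W * Wᵀ).trace := by
  have h0 : 0 ≤ ((c • E - W) * (c • E - W)ᵀ).trace := by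
    have := (posSemidef_self_mul_conjTranspose (c • E - W)).trace_nonneg
    rwa [conjTranspose_eq_transpose_of_trivial] at this
  have h1 : (E * Wᵀ).trace = (W * E).trace := by
    rw [← trace_transpose, transpose_mul, transpose_transpose, hE.eq]
  simp only [transpose_sub, transpose_smul, hE.eq, Matrix.sub_mul, Matrix.mul_sub, trace_sub,
    smul_mul_assoc, mul_smul_comm, trace_smul, smul_eq_mul, h1] at h0
  nlinarith [mul_le_mul_of_nonneg_left h hc]

/-- The error `E` of the difference quotient is tangent and satisfies
`tr (X⁻¹ E Y⁻¹ E) = tr (X⁻¹ Z (X⁻¹ - Y⁻¹) E)` with `X = X t`, `Y = X s` and `Z` the velocity at `X`,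
so it tends to zero because `Y⁻¹` tends to `X⁻¹`. -/
theorem solvesSecondAnsatz_of_isCentralPoint (hP : P.IsPositive) (hF : P.StrictlyFeasible F)
    {X : ℝ → Matrix (Fin n) (Fin n) ℝ} (hX : ∀ t, 0 ≤ t → P.IsCentralPoint F t (X t)) :
    P.SolvesSecondAnsatz (Set.Ici 0) X := by
  intro t ht
  have hcont := continuousOn_of_isCentralPoint hP hF hX t ht
  rw [Set.mem_Ici] at ht
  obtain ⟨q, hq, hqX⟩ := exists_posSemidef_inv_sub hP hF (t + 1)
  rw [hasDerivWithinAt_iff_tendsto_slope, ← vec_velocity]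
  set Z := P.velocity (X t)
  have hZt : P.IsTangent Z := hP.isTangent_velocity (hX t ht).1.2
  set W : ℝ → Matrix (Fin n) (Fin n) ℝ := fun s => (X t)⁻¹ * Z * ((X t)⁻¹ - (X s)⁻¹) with hW
  suffices h : Tendsto (fun s => (s - t)⁻¹ • (X s - X t)) (𝓝[Set.Ici 0 \ {t}] t) (𝓝 Z) by
    have hvec : Continuous (vec : Matrix (Fin n) (Fin n) ℝ → Fin n × Fin n → ℝ) :=
      continuous_pi fun ij => continuous_apply_apply ij.2 ij.1
    exact (hvec.tendsto Z).comp h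
  have hev : ∀ᶠ s in 𝓝[Set.Ici 0 \ {t}] t, 0 ≤ s ∧ s ≠ t ∧ s ≤ t + 1 := by
    filter_upwards [self_mem_nhdsWithin, mem_nhdsWithin_of_mem_nhds
      (Iic_mem_nhds (by linarith : t < t + 1))] with s hs1 hs2
    exact ⟨hs1.1, hs1.2, hs2⟩
  refine tendsto_of_trace_mul_self_le
    (g := fun s => ((q * q) ^ 2)⁻¹ * (W s * (W s)ᵀ).trace) ?_ ?_ ?_
  · filter_upwards [hev] with s hs
    exact ((((hX s hs.1).1.isTangent_sub (hX t ht).1).smul _).sub hZt).isSymm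
  · filter_upwards [hev] with s hs
    set E := (s - t)⁻¹ • (X s - X t) - Z with hE
    have hEt : P.IsTangent E := (((hX s hs.1).1.isTangent_sub (hX t ht).1).smul _).sub hZt
    have h1 := IsCritical.trace_add_eq_zero (hX t ht).1.2 (hX s hs.1).1.2 (hX t ht).isCritical
      (hX s hs.1).isCritical hEt
    have h2 := hP.trace_add_inv_velocity (hX t ht).1.2 hEt
    have h3 := mul_trace_mul_self_le hq.le hEt.isSymm (hqX t _ ht (by linarith) (hX t ht))
      (hqX s _ hs.1 hs.2.2 (hX s hs.1)) (hX s hs.1).1.2.inv.posSemidef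
    have hst : s - t ≠ 0 := sub_ne_zero.mpr hs.2.1
    have h4 : ((X t)⁻¹ * E * (X s)⁻¹ * E).trace = (W s * E).trace := by
      have e1 : (X t)⁻¹ * E * (X s)⁻¹ * E
          = (s - t)⁻¹ • ((X t)⁻¹ * (X s - X t) * (X s)⁻¹ * E)
            - (X t)⁻¹ * Z * (X s)⁻¹ * E := by
        nth_rewrite 1 [hE]
        simp only [Matrix.mul_sub, Matrix.sub_mul, mul_smul_comm, smul_mul_assoc]
      have e2 : W s * E = (X t)⁻¹ * Z * (X t)⁻¹ * E - (X t)⁻¹ * Z * (X s)⁻¹ * E := by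
        simp only [hW, Matrix.mul_sub, Matrix.sub_mul]
      have e3 : (s - t)⁻¹ * ((X t)⁻¹ * (X s - X t) * (X s)⁻¹ * E).trace
          = -(P.C * E).trace := by
        rw [inv_mul_eq_iff_eq_mul₀ hst]
        linarith
      rw [e1, e2, trace_sub, trace_sub, trace_smul, smul_eq_mul, e3]
      linarith
    rw [h4] at h3
    rw [le_inv_mul_iff₀ (by positivity)]
    exact sq_mul_trace_mul_self_le (by positivity) hEt.isSymm h3
  · have hinv := tendsto_inv_of_isUnit 
      (hcont.mono_left (nhdsWithin_mono t (Set.sdiff_subset (t := {t}))))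
      (hX t ht).1.2.det_pos.ne'
    have hc : Continuous fun V : Matrix (Fin n) (Fin n) ℝ =>
        ((q * q) ^ 2)⁻¹ * (((X t)⁻¹ * Z * ((X t)⁻¹ - V)) *
          ((X t)⁻¹ * Z * ((X t)⁻¹ - V))ᵀ).trace := by fun_prop
    have h := (hc.tendsto _).comp hinv
    rw [sub_self, Matrix.mul_zero, Matrix.zero_mul, trace_zero, mul_zero] at h
    exact h

end SDP

/-! ### Solutions of the dynamic follow the central path -/

namespace SDP

variable {n m : ℕ} {P : SDP n m} {F : Matrix (Fin n) (Fin n) ℝ}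
  {Y : ℝ → Matrix (Fin n) (Fin n) ℝ} {Z : Matrix (Fin n) (Fin n) ℝ} {J : Set ℝ} {t T : ℝ}

theorem hasDerivWithinAt_apply (h : HasDerivWithinAt (fun s => vec (Y s)) (vec Z) J t)
    (i j : Fin n) : HasDerivWithinAt (fun s => Y s i j) (Z i j) J t :=
  hasDerivWithinAt_pi.mp h (j, i)

theorem hasDerivWithinAt_trace_mul (h : HasDerivWithinAt (fun s => vec (Y s)) (vec Z) J t)
    (W : Matrix (Fin n) (Fin n) ℝ) :
    HasDerivWithinAt (fun s => (W * Y s).trace) (W * Z).trace J t := by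
  simp only [trace, diag, mul_apply]
  exact HasDerivWithinAt.fun_sum fun i _ => HasDerivWithinAt.fun_sum fun j _ =>
    (hasDerivWithinAt_apply h j i).const_mul _

theorem continuousWithinAt_of_hasDerivWithinAt
    (h : HasDerivWithinAt (fun s => vec (Y s)) (vec Z) J t) : ContinuousWithinAt Y J t :=
  tendsto_pi_nhds.mpr fun i => tendsto_pi_nhds.mpr fun j =>
    (hasDerivWithinAt_apply h i j).continuousWithinAt

/-- The derivative of the inverse, tested against `V`, from `X⁻¹ - Y⁻¹ = X⁻¹ (Y - X) Y⁻¹`. -/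
theorem hasDerivWithinAt_trace_inv_mul
    (h : HasDerivWithinAt (fun s => vec (Y s)) (vec Z) J t) (ht : (Y t).PosDef)
    (hev : ∀ᶠ s in 𝓝[J] t, (Y s).PosDef) (V : Matrix (Fin n) (Fin n) ℝ) :
    HasDerivWithinAt (fun s => ((Y s)⁻¹ * V).trace) (-((Y t)⁻¹ * Z * (Y t)⁻¹ * V).trace) J t := by
  have hle : 𝓝[J \ {t}] t ≤ 𝓝[J] t := nhdsWithin_mono t Set.sdiff_subset
  have hinv := tendsto_inv_of_isUnit
    ((continuousWithinAt_of_hasDerivWithinAt h).mono_left hle) ht.det_pos.ne'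
  have hslope : Tendsto (fun s => (s - t)⁻¹ • (Y s - Y t)) (𝓝[J \ {t}] t) (𝓝 Z) :=
    tendsto_pi_nhds.mpr fun i => tendsto_pi_nhds.mpr fun j =>
      hasDerivWithinAt_iff_tendsto_slope.mp (hasDerivWithinAt_apply h i j)
  rw [hasDerivWithinAt_iff_tendsto_slope]
  have hlim : Tendsto (fun s => -((Y s)⁻¹ * ((s - t)⁻¹ • (Y s - Y t)) * (Y t)⁻¹ * V).trace)
      (𝓝[J \ {t}] t) (𝓝 (-((Y t)⁻¹ * Z * (Y t)⁻¹ * V).trace)) := by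
    have hc : Continuous fun Z : Matrix (Fin n) (Fin n) ℝ => -(Z * ((Y t)⁻¹ * V)).trace := by
      fun_prop
    have h1 : Tendsto (fun s => (Y s)⁻¹ * ((s - t)⁻¹ • (Y s - Y t))) (𝓝[J \ {t}] t)
        (𝓝 ((Y t)⁻¹ * Z)) := hinv.mul hslope
    simpa only [Function.comp_def, ← Matrix.mul_assoc] using
      (hc.tendsto ((Y t)⁻¹ * Z)).comp h1
  refine hlim.congr' ?_
  filter_upwards [hle hev] with s hs
  rw [slope_def_module, ← trace_sub, ← Matrix.sub_mul, inv_sub_inv_eq hs ht,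
    ← trace_smul, ← trace_neg, ← neg_sub (Y s) (Y t)]
  simp only [Matrix.mul_neg, Matrix.neg_mul, smul_neg, smul_mul_assoc, mul_smul_comm]

theorem eq_of_hasDerivWithinAt_zero {f : ℝ → ℝ} {a b : ℝ} (ha : 0 ≤ a) (hab : a ≤ b) (hb : b < T)
    (h : ∀ s ∈ Set.Icc a b, HasDerivWithinAt f 0 (Set.Ico 0 T) s) : f b = f a := by
  refine constant_of_has_deriv_right_zero (a := a) (b := b) (fun s hs => ?_) (fun s hs => ?_) b
    ⟨hab, le_rfl⟩
  · exact (h s hs).continuousWithinAt.mono fun r hr => ⟨ha.trans hr.1, hr.2.trans_lt hb⟩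
  · refine (h s ⟨hs.1, hs.2.le⟩).mono_of_mem_nhdsWithin ?_
    exact mem_of_superset (Ico_mem_nhdsGE (hs.2.trans hb))
      (Set.Ico_subset_Ico_left (ha.trans hs.1))

/-- The velocity is symmetric at every matrix, symmetric or not, so symmetry is never lost. -/
theorem SolvesSecondAnsatz.isSymm (hP : P.IsPositive)
    (hY : P.SolvesSecondAnsatz (Set.Ico 0 T) Y) (h0 : (Y 0).IsSymm) {s : ℝ}
    (hs : s ∈ Set.Ico 0 T) : (Y s).IsSymm := by
  refine IsSymm.ext fun i j => ?_
  have h := eq_of_hasDerivWithinAt_zero (f := fun r => Y r j i - Y r i j) le_rfl hs.1 hs.2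
    fun r hr => by
      have hd := hY r ⟨hr.1, hr.2.trans_lt hs.2⟩
      rw [← vec_velocity] at hd
      have h1 := (hasDerivWithinAt_apply hd j i).sub (hasDerivWithinAt_apply hd i j)
      rwa [(hP.isSymm_velocity (Y r)).apply i j, sub_self] at h1
  simp only [h0.apply i j, sub_self] at h
  exact sub_eq_zero.mp h

theorem constraintMatrix_mulVec_vec_apply (hP : P.IsPositive) (X : Matrix (Fin n) (Fin n) ℝ)
    (ℓ : Fin m) : (P.constraintMatrix *ᵥ vec X) ℓ = (P.A ℓ * X).trace := by
  have h := vec_dotProduct_vec (P.A ℓ) X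
  rwa [(hP.symm_A ℓ).eq] at h

/-- As long as a solution stays positive definite, the first order condition is conserved. -/
theorem SolvesSecondAnsatz.isCentralPoint_of_posDef (hP : P.IsPositive)
    (hY : P.SolvesSecondAnsatz (Set.Ico 0 T) Y) {a b : ℝ} (ha : 0 ≤ a) (hab : a ≤ b) (hb : b < T)
    (hpd : ∀ s ∈ Set.Icc a b, ∀ᶠ r in 𝓝[Set.Ico 0 T] s, (Y r).PosDef)
    (hYa : P.IsCentralPoint F a (Y a)) : P.IsCentralPoint F b (Y b) := by
  have hmem : ∀ s ∈ Set.Icc a b, s ∈ Set.Ico 0 T := fun s hs =>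
    ⟨ha.trans hs.1, hs.2.trans_lt hb⟩
  have hpd' : ∀ s ∈ Set.Icc a b, (Y s).PosDef := fun s hs =>
    (hpd s hs).self_of_nhdsWithin (hmem s hs)
  refine IsCritical.isCentralPoint ⟨?_, hpd' b ⟨hab, le_rfl⟩⟩ fun V hV => ?_
  · rw [LinearlyFeasible, ← hYa.1.1]
    ext ℓ
    rw [constraintMatrix_mulVec_vec_apply hP, constraintMatrix_mulVec_vec_apply hP]
    refine eq_of_hasDerivWithinAt_zero (f := fun s => (P.A ℓ * Y s).trace) ha hab hb
      fun s hs => ?_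
    have hd := hY s (hmem s hs)
    rw [← vec_velocity] at hd
    have h1 := hasDerivWithinAt_trace_mul hd (P.A ℓ)
    rwa [← constraintMatrix_mulVec_vec_apply hP,
      (hP.isTangent_velocity (hpd' s hs)).mulVec_vec] at h1
  · rw [← hYa.isCritical V hV]
    refine eq_of_hasDerivWithinAt_zero
      (f := fun s => ((s • P.C + F⁻¹ - (Y s)⁻¹) * V).trace) ha hab hb fun s hs => ?_
    have hd := hY s (hmem s hs)
    rw [← vec_velocity] at hd
    have h1 := hasDerivWithinAt_trace_inv_mul hd (hpd' s hs) (hpd s hs) V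
    have h2 : HasDerivWithinAt (fun s : ℝ => s * (P.C * V).trace + (F⁻¹ * V).trace)
        (1 * (P.C * V).trace) (Set.Ico 0 T) s :=
      ((hasDerivWithinAt_id s _).mul_const _).add_const _
    have h3 := h2.fun_sub h1
    rw [one_mul, sub_neg_eq_add, hP.trace_add_inv_velocity (hpd' s hs) hV] at h3
    have heq : ∀ r : ℝ, ((r • P.C + F⁻¹ - (Y r)⁻¹) * V).trace
        = r * (P.C * V).trace + (F⁻¹ * V).trace - ((Y r)⁻¹ * V).trace := fun r => by
      rw [Matrix.sub_mul, Matrix.add_mul, trace_sub, trace_add, smul_mul_assoc, trace_smul,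
        smul_eq_mul]
    exact h3.congr (fun r _ => heq r) (heq s)

theorem SolvesSecondAnsatz.continuousOn (hY : P.SolvesSecondAnsatz J Y) : ContinuousOn Y J :=
  fun t ht => continuousWithinAt_of_hasDerivWithinAt (Z := P.velocity (Y t)) (hY t ht)

/-- A solution starting at `F` stays on the central path. -/
theorem SolvesSecondAnsatz.eqOn (hP : P.IsPositive) (hF : P.StrictlyFeasible F)
    {X : ℝ → Matrix (Fin n) (Fin n) ℝ} (hX : ∀ t, 0 ≤ t → P.IsCentralPoint F t (X t))
    (hY : P.SolvesSecondAnsatz (Set.Ico 0 T) Y) (h0 : Y 0 = F) :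
    Set.EqOn Y X (Set.Ico 0 T) := by
  intro b hb
  have hsub : Set.Icc 0 b ⊆ Set.Ico 0 T := Set.Icc_subset_Ico_right hb.2
  have hYsymm : ∀ s ∈ Set.Ico 0 T, (Y s).IsSymm := fun s hs =>
    hY.isSymm hP (h0 ▸ hF.2.isSymm) hs
  have hclosed : IsClosed ({s | Y s = X s} ∩ Set.Icc 0 b) := by
    have h := ((hY.continuousOn.mono hsub).sub
      ((continuousOn_of_isCentralPoint hP hF hX).mono
        (Set.Icc_subset_Ici_self))).preimage_isClosed_of_isClosed isClosed_Icc
      (isClosed_singleton (x := (0 : Matrix (Fin n) (Fin n) ℝ)))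
    convert h using 1
    ext s
    simp only [Set.mem_inter_iff, Set.mem_ofPred_eq, Set.mem_preimage, Set.mem_singleton_iff,
      Pi.sub_apply, sub_eq_zero, and_comm]
  -- the set where `Y` agrees with the central path is closed; being positive definite is an open
  -- condition, so that it is also open to the right
  refine hclosed.Icc_subset_of_forall_mem_nhdsWithin ?_ (fun a ha => ?_) ⟨hb.1, le_rfl⟩
  · exact h0.trans (hF.isCentralPoint_zero.unique (hX 0 le_rfl)).symm
  · have ha0 : 0 ≤ a := ha.2.1
    have haT : a < T := ha.2.2.trans hb.2
    have hYa : P.IsCentralPoint F a (Y a) := by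
      have h : Y a = X a := ha.1
      rw [h]
      exact hX a ha0
    have hnear : ∀ᶠ s in 𝓝[Set.Ico 0 T] a, (Y s).PosDef := by
      filter_upwards [(hY.continuousOn a ⟨ha0, haT⟩).eventually hYa.1.2.eventually_nhds,
        self_mem_nhdsWithin] with s hs hsT
      exact hs (hYsymm s hsT)
    obtain ⟨U, hU, haU, hUsub⟩ := mem_nhdsWithin.mp hnear
    obtain ⟨c, hac, hcU⟩ := exists_Ico_subset_of_mem_nhds (hU.mem_nhds haU) ⟨T, haT⟩
    have hmem : Set.Ioo a (min c T) ∈ 𝓝[>] a := Ioo_mem_nhdsGT (lt_min hac haT)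
    filter_upwards [hmem] with s hs
    have hsc : s < c := hs.2.trans_le (min_le_left _ _)
    have hsT : s < T := hs.2.trans_le (min_le_right _ _)
    refine (hX s (ha0.trans hs.1.le)).unique
      (hY.isCentralPoint_of_posDef hP ha0 hs.1.le hsT (fun r hr => ?_) hYa)
    have hrU : r ∈ U := hcU ⟨hr.1, hr.2.trans_lt hsc⟩
    exact mem_of_superset (inter_mem_nhdsWithin (Set.Ico 0 T) (hU.mem_nhds hrU))
      fun x hx => hUsub ⟨hx.2, hx.1⟩

end SDP

section Oscillation

open scoped Polynomial

/-! ### Oscillating functions satisfy no polynomial equation -/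

theorem frequently_eq_of_frequently_lt_of_frequently_gt {x : ℝ → ℝ}
    (hx : ContinuousOn x (Set.Ici 0)) {c : ℝ} (h1 : ∃ᶠ t in atTop, x t < c)
    (h2 : ∃ᶠ t in atTop, c < x t) : ∃ᶠ t in atTop, x t = c := by
  rw [frequently_atTop] at h1 h2 ⊢
  intro T
  obtain ⟨r, hr, hrc⟩ := h1 (max T 0)
  obtain ⟨s, hs, hsc⟩ := h2 (max T 0)
  have hsub : Set.uIcc r s ⊆ Set.Ici (max T 0) := fun z hz => (le_min hr hs).trans hz.1
  obtain ⟨t, ht, htc⟩ := intermediate_value_uIcc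
    (hx.mono (hsub.trans (Set.Ici_subset_Ici.mpr (le_max_right _ _))))
    (Set.mem_uIcc.mpr (Or.inl ⟨hrc.le, hsc.le⟩))
  exact ⟨t, (le_max_left _ _).trans (hsub ht), htc⟩

/-- A polynomial relation `p (t, x t) = 0` valid for all large `t` would have to hold identically
at every level `c` which `x` crosses infinitely often. -/
theorem frequently_evalEval_ne_zero {x : ℝ → ℝ} (hx : ContinuousOn x (Set.Ici 0)) {a b : ℝ}
    (hab : a < b) (ha : ∃ᶠ t in atTop, x t < a) (hb : ∃ᶠ t in atTop, b < x t)
    {p : ℝ[X][X]} (hp : p ≠ 0) : ∃ᶠ t in atTop, p.evalEval t (x t) ≠ 0 := by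
  obtain ⟨c, hc, hcp⟩ : ∃ c ∈ Set.Ioo a b, p.eval (Polynomial.C c) ≠ 0 := by
    by_contra! h
    have hfin : {q | p.IsRoot q}.Finite := Polynomial.finite_setOfPred_isRoot hp
    exact (Set.Ioo_infinite hab)
      ((hfin.preimage Polynomial.C_injective.injOn).subset fun c hc => h c hc)
  have h1 := frequently_eq_of_frequently_lt_of_frequently_gt hx
    (ha.mono fun t ht => ht.trans hc.1) (hb.mono fun t ht => hc.2.trans ht)
  refine (h1.and_eventually (Polynomial.eventually_atTop_not_isRoot _ hcp)).mono ?_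
  rintro t ⟨ht, hroot⟩
  rw [Polynomial.evalEval, ht]
  exact hroot

theorem exists_ultrafilter_evalEval_ne_zero {x : ℝ → ℝ} (hx : ContinuousOn x (Set.Ici 0))
    {a b : ℝ} (hab : a < b) (ha : ∃ᶠ t in atTop, x t < a) (hb : ∃ᶠ t in atTop, b < x t) :
    ∃ u : Ultrafilter ℝ, (u : Filter ℝ) ≤ atTop ∧
      ∀ p : ℝ[X][X], p ≠ 0 → ∀ᶠ t in (u : Filter ℝ), p.evalEval t (x t) ≠ 0 := by
  set f : {p : ℝ[X][X] // p ≠ 0} → Filter ℝ :=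
    fun p => atTop ⊓ 𝓟 {t | p.1.evalEval t (x t) ≠ 0}
  have : Nonempty {p : ℝ[X][X] // p ≠ 0} := ⟨⟨1, one_ne_zero⟩⟩
  have hne : NeBot (iInf f) := by
    refine iInf_neBot_of_directed' (fun p q => ⟨⟨p.1 * q.1, mul_ne_zero p.2 q.2⟩, ?_, ?_⟩)
      fun p => frequently_iff_neBot.mp (frequently_evalEval_ne_zero hx hab ha hb p.2)
    · refine inf_le_inf_left _ (principal_mono.mpr fun t ht => ?_)
      exact left_ne_zero_of_mul ((Polynomial.evalEval_mul t (x t) p.1 q.1).symm.trans_ne ht)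
    · refine inf_le_inf_left _ (principal_mono.mpr fun t ht => ?_)
      exact right_ne_zero_of_mul ((Polynomial.evalEval_mul t (x t) p.1 q.1).symm.trans_ne ht)
  refine ⟨Ultrafilter.of (iInf f), ?_, fun p hp => ?_⟩
  · exact (Ultrafilter.of_le _).trans
      ((iInf_le f (Classical.arbitrary _)).trans inf_le_left)
  · exact ((Ultrafilter.of_le _).trans ((iInf_le f ⟨p, hp⟩).trans inf_le_right))
      (mem_principal_self _)

end Oscillation

section Algebraic

/-! ### Algebraicity from nondegenerate polynomial equations -/

open IntermediateField in
/-- A finite set of field elements is algebraic as soon as every derivation of the field it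
generates kills it. -/
theorem isAlgebraic_of_forall_derivation_eq_zero {k L : Type} [Field k] [Field L] [Algebra k L]
    {S : Set L} (hS : S.Finite)
    (h : ∀ d : Derivation k (adjoin k S) L, ∀ x (hx : x ∈ S), d ⟨x, subset_adjoin k S hx⟩ = 0)
    {x : L} (hx : x ∈ S) : IsAlgebraic k x := by
  have hd : ∀ d : Derivation k (adjoin k S) L, ∀ z, d z = 0 := by
    rintro d ⟨z, hz⟩
    refine adjoin_induction k (p := fun z hz => d ⟨z, hz⟩ = 0) (h d) ?_ ?_ ?_ ?_ hz
    · exact fun a => d.map_algebraMap a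
    · intro y z hy hz h1 h2
      have := d.map_add ⟨y, hy⟩ ⟨z, hz⟩
      rw [h1, h2, add_zero] at this
      exact this
    · intro y hy h1
      have := d.leibniz_inv ⟨y, hy⟩
      rw [h1, smul_zero] at this
      exact this
    · intro y z hy hz h1 h2
      have := d.leibniz ⟨y, hy⟩ ⟨z, hz⟩
      rw [h1, h2, smul_zero, smul_zero, add_zero] at this
      exact this
  have hD : ∀ z, KaehlerDifferential.D k (adjoin k S) z = 0 := by
    intro z
    refine (Module.forall_dual_apply_eq_zero_iff (adjoin k S) _).mp fun φ => ?_
    have := hd (((Algebra.linearMap (adjoin k S) L).comp φ).compDer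
      (KaehlerDifferential.D k (adjoin k S))) z
    exact (algebraMap (adjoin k S) L).injective (this.trans (map_zero _).symm)
  have hsub : Subsingleton (Ω[(adjoin k S)⁄k]) := by
    refine (Submodule.subsingleton_iff (adjoin k S)).mp (subsingleton_of_bot_eq_top ?_)
    rw [← KaehlerDifferential.span_range_derivation, eq_comm, Submodule.span_eq_bot]
    rintro _ ⟨z, rfl⟩
    exact hD z
  have : Algebra.FormallyUnramified k (adjoin k S) := ⟨hsub⟩
  have : Algebra.EssFiniteType k (adjoin k S) :=
    IntermediateField.essFiniteType_iff.mpr (fg_adjoin_of_finite hS)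
  have hsep := Algebra.FormallyUnramified.isSeparable k (adjoin k S)
  exact (isAlgebraic_algebraMap_iff (algebraMap (adjoin k S) L).injective).mpr
    (Algebra.IsAlgebraic.isAlgebraic (⟨x, subset_adjoin k S hx⟩ : adjoin k S))

/-- If `X` satisfies the linear equations `A vec X = b` and `X⁻¹` lies in the affine space
`c + range Aᵀ`, then a derivation `d` gives `tr (dX X⁻¹ dX X⁻¹) = 0`; when this form is anisotropic,
`dX = 0`, so `X` is algebraic over the field of coefficients. -/
theorem isAlgebraic_apply_of_anisotropic {ι κ : Type} [Fintype ι] [Fintype κ] [DecidableEq ι]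
    {k L : Type} [Field k] [Field L] [Algebra k L] {X Z : Matrix ι ι L} (hX : X.IsSymm)
    (hXZ : X * Z = 1) (A B : Matrix κ (ι × ι) k) (b : κ → k) (c : Matrix ι ι k)
    (hb : A.map (algebraMap k L) *ᵥ vec X = algebraMap k L ∘ b)
    (hc : (Aᵀ * B).map (algebraMap k L) *ᵥ vec (c.map (algebraMap k L) - Z)
      = vec (c.map (algebraMap k L) - Z))
    (haniso : ∀ D : Matrix ι ι L, D.IsSymm → (D * Z * D * Z).trace = 0 → D = 0) (i j : ι) :
    IsAlgebraic k (X i j) := by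
  set S : Set L := Set.range (fun q : ι × ι => X q.1 q.2) ∪
    Set.range (fun q : ι × ι => Z q.1 q.2) with hS
  have hmX : ∀ i j, X i j ∈ S := fun i j => Or.inl ⟨(i, j), rfl⟩
  have hmZ : ∀ i j, Z i j ∈ S := fun i j => Or.inr ⟨(i, j), rfl⟩
  refine isAlgebraic_of_forall_derivation_eq_zero (S := S)
    ((Set.finite_range _).union (Set.finite_range _)) (fun d => ?_) (hmX i j)
  set X' : Matrix ι ι (IntermediateField.adjoin k S) :=
    of fun i j => ⟨X i j, IntermediateField.subset_adjoin k S (hmX i j)⟩ with hX'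
  set Z' : Matrix ι ι (IntermediateField.adjoin k S) :=
    of fun i j => ⟨Z i j, IntermediateField.subset_adjoin k S (hmZ i j)⟩ with hZ'
  set dX : Matrix ι ι L := of fun i j => d (X' i j) with hdX
  set dZ : Matrix ι ι L := of fun i j => d (Z' i j)
  have hdXs : dX.IsSymm := by
    refine IsSymm.ext fun i j => ?_
    have : X' j i = X' i j := Subtype.ext (hX.apply i j)
    simp only [hdX, of_apply, this]
  have hinv : X * dZ + dX * Z = 0 := by
    ext i j
    have h1 : ∑ l, X' i l * Z' l j = algebraMap k _ ((1 : Matrix ι ι k) i j) := by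
      apply Subtype.ext
      have := congrFun (congrFun hXZ i) j
      rw [mul_apply] at this
      simp only [hX', hZ', of_apply, AddSubmonoidClass.coe_finsetSum, MulMemClass.mk_mul_mk,
        this, one_apply]
      split_ifs <;> simp
    have h2 := congrArg d h1
    rw [d.map_algebraMap, map_sum] at h2
    simp only [Derivation.leibniz, Finset.sum_add_distrib] at h2
    simp only [Matrix.add_apply, mul_apply, Matrix.zero_apply]
    rw [← h2]
    congr 1
    refine Finset.sum_congr rfl fun l _ => ?_
    rw [mul_comm]
    rfl
  have hZX : Z * X = 1 := mul_eq_one_comm.mp hXZ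
  have hdZ_eq : dZ = -(Z * dX * Z) := by
    have h1 := congrArg (Z * ·) hinv
    simp only [Matrix.mul_add, ← Matrix.mul_assoc, hZX, Matrix.one_mul, Matrix.mul_zero] at h1
    exact eq_neg_of_add_eq_zero_left h1
  -- a linear relation with coefficients in `k` can be differentiated
  have hlin : ∀ {τ : Type} (M : Matrix τ (ι × ι) k) (v : ι × ι → IntermediateField.adjoin k S)
      (w : τ → IntermediateField.adjoin k S),
      M.map (algebraMap k L) *ᵥ (fun q => (v q : L)) = (fun r => (w r : L)) →
      M.map (algebraMap k L) *ᵥ (fun q => d (v q)) = fun r => d (w r) := by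
    intro τ M v w hvw
    ext r
    have h1 : ∑ q, M r q • v q = w r := by
      apply Subtype.ext
      rw [← congrFun hvw r]
      simp [mulVec, dotProduct, Algebra.smul_def]
    rw [← h1, map_sum]
    simp [mulVec, dotProduct, Algebra.smul_def]
  have hA : A.map (algebraMap k L) *ᵥ vec dX = 0 := by
    have := hlin A (vec X') (fun l => algebraMap k _ (b l)) hb
    simp only [d.map_algebraMap] at this
    exact this
  have hB : (Aᵀ * B).map (algebraMap k L) *ᵥ vec dZ = vec dZ := by
    set E : Matrix ι ι (IntermediateField.adjoin k S) := c.map (algebraMap k _) - Z'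
    have := hlin (Aᵀ * B) (vec E) (vec E) hc
    have h2 : (fun q => d (vec E q)) = -vec dZ := by
      ext q
      change d (algebraMap k _ (c q.2 q.1) - Z' q.2 q.1) = -d (Z' q.2 q.1)
      rw [map_sub, d.map_algebraMap, zero_sub]
    rw [h2, mulVec_neg, neg_inj] at this
    exact this
  have htr : (dX * dZ).trace = 0 := by
    have h1 := vec_dotProduct_vec dX dZ
    rw [hdXs.eq, ← hB, Matrix.map_mul, ← mulVec_mulVec, dotProduct_mulVec,
      Matrix.transpose_map, vecMul_transpose, hA, zero_dotProduct] at h1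
    exact h1.symm
  have hzero : dX = 0 := by
    refine haniso dX hdXs ?_
    rw [hdZ_eq, mul_neg, trace_neg, neg_eq_zero] at htr
    simpa only [Matrix.mul_assoc] using htr
  rintro x (⟨q, rfl⟩ | ⟨q, rfl⟩)
  · exact congrFun (congrFun hzero q.1) q.2
  · rw [hzero, Matrix.mul_zero, Matrix.zero_mul, neg_zero] at hdZ_eq
    exact congrFun (congrFun hdZ_eq q.1) q.2

end Algebraic

section Germs

open scoped Polynomial

/-! ### Matrices over a field of germs -/

/-- Two matrices of germs agree if and only if the matrices of functions representing them agree
pointwise along the ultrafilter. -/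
theorem map_coeRingHom_eq_iff {ι κ : Type*} [Fintype ι] [Fintype κ] {u : Ultrafilter ℝ}
    {M N : Matrix ι κ (ℝ → ℝ)} :
    M.map (Germ.coeRingHom (u : Filter ℝ)) = N.map (Germ.coeRingHom (u : Filter ℝ)) ↔
      ∀ᶠ t in (u : Filter ℝ), M.map (Pi.evalRingHom _ t) = N.map (Pi.evalRingHom _ t) := by
  simp only [← Matrix.ext_iff, map_apply, eventually_all]
  exact forall_congr' fun i => forall_congr' fun j => Germ.coe_eq

/-- Polynomials as functions on the real line. -/
noncomputable def polynomialToFun : ℝ[X] →+* (ℝ → ℝ) :=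
  RingHom.pi fun t => Polynomial.evalRingHom t

theorem eval₂_polynomialToFun (p : ℝ[X][X]) (x : ℝ → ℝ) :
    p.eval₂ polynomialToFun x = fun t => p.evalEval t (x t) := by
  ext t
  have h := Polynomial.hom_eval₂ p polynomialToFun (Pi.evalRingHom (fun _ : ℝ => ℝ) t) x
  rw [← Polynomial.eval₂_evalRingHom]
  exact h

/-- Along an ultrafilter `u ≤ atTop`, the entries of a curve of positive definite matrices that
satisfies the linear equations `A vec X = b` and `X⁻¹ - (t C₁ + C₀) ∈ range Aᵀ` satisfy polynomial
equations over `ℝ[t]`. -/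
theorem exists_evalEval_eventually_eq_zero {ι κ : Type} [Fintype ι] [Fintype κ] [DecidableEq ι]
    {u : Ultrafilter ℝ} (hu : (u : Filter ℝ) ≤ atTop) {X : ℝ → Matrix ι ι ℝ}
    (hX : ∀ᶠ t in (u : Filter ℝ), (X t).PosDef) (A B : Matrix κ (ι × ι) ℝ) (b : κ → ℝ)
    (C₁ C₀ : Matrix ι ι ℝ) (hb : ∀ᶠ t in (u : Filter ℝ), A *ᵥ vec (X t) = b)
    (hc : ∀ᶠ t in (u : Filter ℝ),
      (Aᵀ * B) *ᵥ vec (t • C₁ + C₀ - (X t)⁻¹) = vec (t • C₁ + C₀ - (X t)⁻¹)) (i j : ι) :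
    ∃ p : ℝ[X][X], p ≠ 0 ∧ ∀ᶠ t in (u : Filter ℝ), p.evalEval t (X t i j) = 0 := by
  let L := Germ (u : Filter ℝ) ℝ
  set Φ : (ℝ → ℝ) →+* L := Germ.coeRingHom (u : Filter ℝ)
  let _ : Algebra ℝ[X] L := (Φ.comp polynomialToFun).toAlgebra
  -- the germ of the identity is transcendental, because `u` contains all neighbourhoods of infinity
  have hinj : Function.Injective (algebraMap ℝ[X] L) := by
    refine (injective_iff_map_eq_zero _).mpr fun p hp => ?_
    by_contra hne
    have h1 : ∀ᶠ t in (u : Filter ℝ), p.eval t = 0 := Germ.coe_eq.mp hp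
    obtain ⟨t, ht1, ht2⟩ := (h1.and (hu (Polynomial.eventually_atTop_not_isRoot p hne))).exists
    exact ht2 ht1
  have : FaithfulSMul ℝ[X] L := (faithfulSMul_iff_algebraMap_injective ℝ[X] L).mpr hinj
  let _ : Algebra (FractionRing ℝ[X]) L := FractionRing.liftAlgebra ℝ[X] L
  have : IsScalarTower ℝ[X] (FractionRing ℝ[X]) L := FractionRing.isScalarTower_liftAlgebra _ _
  let k := FractionRing ℝ[X]
  have halg : ∀ p : ℝ[X], algebraMap k L (algebraMap ℝ[X] k p) = Φ (polynomialToFun p) :=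
    fun p => (IsScalarTower.algebraMap_apply ℝ[X] k L p).symm
  set cst : ℝ →+* k := (algebraMap ℝ[X] k).comp Polynomial.C
  set Xf : Matrix ι ι (ℝ → ℝ) := of fun i j t => X t i j
  set Zf : Matrix ι ι (ℝ → ℝ) := of fun i j t => (X t)⁻¹ i j
  have hXf_ev : ∀ t, Xf.map (Pi.evalRingHom _ t) = X t := fun t => rfl
  have hZf_ev : ∀ t, Zf.map (Pi.evalRingHom _ t) = (X t)⁻¹ := fun t => rfl
  -- constant matrices, as matrices of functions
  have hcstmap : ∀ {τ σ : Type} (M : Matrix τ σ ℝ),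
      (M.map cst).map (algebraMap k L) = (M.map (Pi.constRingHom ℝ ℝ)).map Φ := by
    intro τ σ M
    ext r s
    refine (halg (Polynomial.C (M r s))).trans (congrArg Φ ?_)
    ext t
    exact Polynomial.eval_C
  suffices h : IsAlgebraic k (Xf.map Φ i j) by
    obtain ⟨p, hp, hpx⟩ := (IsFractionRing.isAlgebraic_iff ℝ[X] k L).mpr h
    refine ⟨p, hp, ?_⟩
    have h1 : Polynomial.aeval (Xf.map Φ i j) p = Φ (p.eval₂ polynomialToFun (Xf i j)) :=
      (Polynomial.hom_eval₂ p polynomialToFun Φ (Xf i j)).symm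
    rw [h1, eval₂_polynomialToFun] at hpx
    exact Germ.coe_eq.mp hpx
  set c : Matrix ι ι k := of fun i j =>
    algebraMap ℝ[X] k (Polynomial.X * Polynomial.C (C₁ i j) + Polynomial.C (C₀ i j))
  set cf : Matrix ι ι (ℝ → ℝ) := of fun i j t => (t • C₁ + C₀) i j
  have hcmap : c.map (algebraMap k L) = cf.map Φ := by
    ext r s
    refine (halg _).trans (congrArg Φ ?_)
    ext t
    simp [polynomialToFun, cf, mul_comm t]
  refine isAlgebraic_apply_of_anisotropic (X := Xf.map Φ) (Z := Zf.map Φ) ?_ ?_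
    (A.map cst) (B.map cst) (cst ∘ b) c ?_ ?_ ?_ i j
  · rw [IsSymm, ← Matrix.transpose_map, map_coeRingHom_eq_iff]
    filter_upwards [hX] with t ht
    exact ht.isSymm
  · have h1 : (1 : Matrix ι ι L) = (1 : Matrix ι ι (ℝ → ℝ)).map Φ :=
      (Matrix.map_one _ (map_zero _) (map_one _)).symm
    rw [h1, ← Matrix.map_mul, map_coeRingHom_eq_iff]
    filter_upwards [hX] with t ht
    rw [Matrix.map_mul, hXf_ev, hZf_ev, Matrix.map_one _ (map_zero _) (map_one _)]
    exact mul_nonsing_inv _ ((isUnit_iff_isUnit_det _).mp ht.isUnit)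
  · rw [hcstmap]
    ext l
    refine (RingHom.map_mulVec Φ _ (vec Xf) l).symm.trans ?_
    refine Eq.trans ?_ (halg (Polynomial.C (b l))).symm
    refine Germ.coe_eq.mpr ?_
    filter_upwards [hb] with t ht
    refine (RingHom.map_mulVec (Pi.evalRingHom (fun _ : ℝ => ℝ) t) _ (vec Xf) l).trans ?_
    exact (congrFun ht l).trans Polynomial.eval_C.symm
  · rw [← Matrix.transpose_map, ← Matrix.map_mul, hcstmap, hcmap, ← Matrix.map_sub _ (map_sub Φ)]
    ext l
    refine (RingHom.map_mulVec Φ _ (vec (cf - Zf)) l).symm.trans ?_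
    refine Germ.coe_eq.mpr ?_
    filter_upwards [hc] with t ht
    refine (RingHom.map_mulVec (Pi.evalRingHom (fun _ : ℝ => ℝ) t) _
      (vec (cf - Zf)) l).trans ?_
    exact congrFun ht l
  · intro D hDs hD
    obtain ⟨Df, rfl⟩ : ∃ Df : Matrix ι ι (ℝ → ℝ), Df.map Φ = D := by
      choose f hf using fun i j => Quotient.exists_rep (D i j)
      exact ⟨of f, by ext i j; exact hf i j⟩
    rw [IsSymm, ← Matrix.transpose_map, map_coeRingHom_eq_iff] at hDs
    rw [← Matrix.map_mul, ← Matrix.map_mul, ← Matrix.map_mul, ← AddMonoidHom.map_trace Φ] at hD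
    have hD' : ∀ᶠ t in (u : Filter ℝ), (Df * Zf * Df * Zf).trace t = 0 := Germ.coe_eq.mp hD
    rw [show (0 : Matrix ι ι L) = (0 : Matrix ι ι (ℝ → ℝ)).map Φ from
      (Matrix.map_zero _ (map_zero _)).symm, map_coeRingHom_eq_iff]
    -- anisotropy is inherited from the pointwise inequality for real matrices
    filter_upwards [hX, hDs, hD'] with t ht hst htr
    have h1 := AddMonoidHom.map_trace (Pi.evalRingHom (fun _ : ℝ => ℝ) t) (Df * Zf * Df * Zf)
    rw [Matrix.map_mul, Matrix.map_mul, Matrix.map_mul, hZf_ev] at h1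
    rw [Matrix.map_zero _ (map_zero _)]
    set E := Df.map (Pi.evalRingHom (fun _ : ℝ => ℝ) t)
    have hEs : E.IsSymm := hst
    obtain ⟨p, hp, hpX⟩ := ht.inv.exists_pos_posSemidef_sub
    have h2 := mul_trace_mul_self_le hp.le hEs hpX hpX ht.inv.posSemidef
    have h3 : ((X t)⁻¹ * E * (X t)⁻¹ * E).trace = 0 := by
      rw [Matrix.trace_mul_comm, ← Matrix.mul_assoc, ← Matrix.mul_assoc, ← h1]
      exact htr
    rw [h3] at h2
    have h4 := nonpos_of_mul_nonpos_right h2 (mul_pos hp hp)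
    ext r s
    have h5 := (hEs.sq_le_trace_mul_self r s).trans h4
    exact pow_eq_zero_iff two_ne_zero |>.mp (le_antisymm h5 (sq_nonneg _))

end Germs

/-! ### Convergence of the central path -/

namespace SDP

variable {n m : ℕ} {P : SDP n m} {F : Matrix (Fin n) (Fin n) ℝ}
  {X : ℝ → Matrix (Fin n) (Fin n) ℝ}

/-- At a central point the gradient of the objective is a combination of the constraint matrices:
it is fixed by the orthogonal projection `𝒜ᵀ (𝒜 𝒜ᵀ)† 𝒜` onto their span. -/
theorem IsCentralPoint.mulVec_gradient_eq (hP : P.IsPositive) (hF : P.StrictlyFeasible F) {t : ℝ}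
    {X : Matrix (Fin n) (Fin n) ℝ} (hX : P.IsCentralPoint F t X) :
    (P.constraintMatrixᵀ * (pinv (P.constraintMatrix * P.constraintMatrixᵀ) *
      P.constraintMatrix)) *ᵥ vec (t • P.C + F⁻¹ - X⁻¹) = vec (t • P.C + F⁻¹ - X⁻¹) := by
  set H := t • P.C + F⁻¹ - X⁻¹ with hH
  set y := (pinv (P.constraintMatrix * P.constraintMatrixᵀ) * P.constraintMatrix) *ᵥ vec H with hy
  have hHs : H.IsSymm := by
    simp only [hH, IsSymm, transpose_sub, transpose_add, transpose_smul, hP.posDef_C.isSymm.eq,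
      hF.2.inv.isSymm.eq, hX.1.2.inv.isSymm.eq]
  have h1 := mul_pinv_mul_of_posDef P.constraintMatrix
    (PosDef.one (n := Fin n × Fin n) (R := ℝ))
  rw [Matrix.mul_one] at h1
  have hV : P.IsTangent (H - P.combination y) := by
    refine ⟨hHs.sub (hP.isSymm_combination y), ?_⟩
    rw [vec_sub, mulVec_sub, vec_combination, hy, mulVec_mulVec, mulVec_mulVec,
      ← Matrix.mul_assoc, h1, sub_self]
  have h2 : ((H - P.combination y) * (H - P.combination y)).trace = 0 := by
    rw [Matrix.sub_mul, trace_sub, hX.isCritical _ hV, hP.trace_combination_mul y hV.mulVec_vec,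
      sub_self]
  have h3 : H = P.combination y := by
    ext i j
    have h4 := (hV.isSymm.sq_le_trace_mul_self i j).trans h2.le
    exact sub_eq_zero.mp (pow_eq_zero_iff two_ne_zero |>.mp (le_antisymm h4 (sq_nonneg _)))
  rw [← mulVec_mulVec, ← hy, ← vec_combination, ← h3]

theorem exists_trace_le_of_one_le (hP : P.IsPositive) (hF : P.StrictlyFeasible F) :
    ∃ R : ℝ, ∀ t X, 1 ≤ t → P.IsCentralPoint F t X → X.trace ≤ R := by
  obtain ⟨c, hc, hcC⟩ := hP.posDef_C.exists_pos_posSemidef_sub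
  refine ⟨((P.C * F).trace + 2 * n) / c, fun t X ht hX => ?_⟩
  have h1 := hX.smul_gap_le hF.feasible
  rw [hF.trace_inv_mul_self] at h1
  have h2 := hcC.trace_mul_nonneg hX.1.2.posSemidef
  rw [Matrix.sub_mul, trace_sub, smul_mul_assoc, trace_smul, Matrix.one_mul, smul_eq_mul] at h2
  have h3 := hF.2.inv.posSemidef.trace_mul_nonneg hX.1.2.posSemidef
  have hn : (0 : ℝ) ≤ n := Nat.cast_nonneg n
  have h4 : (P.C * X).trace ≤ (P.C * F).trace + 2 * n := by
    by_contra! hlt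
    nlinarith
  rw [le_div_iff₀ hc]
  linarith

/-- An entry of the path that oscillated would be transcendental over `ℝ(t)` along an ultrafilter
along which it is algebraic. -/
theorem exists_tendsto_apply (hP : P.IsPositive) (hF : P.StrictlyFeasible F)
    (hX : ∀ t, 0 ≤ t → P.IsCentralPoint F t (X t)) (i j : Fin n) :
    ∃ c : ℝ, Tendsto (fun t => X t i j) atTop (𝓝 c) := by
  obtain ⟨R, hR⟩ := exists_trace_le_of_one_le hP hF
  have hbound : ∀ᶠ t in atTop, |X t i j| ≤ R := by
    filter_upwards [eventually_ge_atTop 1] with t ht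
    have hXt := hX t (zero_le_one.trans ht)
    exact (hXt.1.2.posSemidef.abs_apply_le_trace i j).trans (hR t _ ht hXt)
  refine tendsto_of_no_upcrossings dense_univ ?_
    ⟨R, eventually_map.mpr (hbound.mono fun t ht => (abs_le.mp ht).2)⟩
    ⟨-R, eventually_map.mpr (hbound.mono fun t ht => (abs_le.mp ht).1)⟩
  rintro a - b - hab ⟨ha, hb⟩
  have hcont : ContinuousOn (fun t => X t i j) (Set.Ici 0) := fun t ht =>
    ((continuous_apply_apply i j).tendsto (X t)).comp
      (continuousOn_of_isCentralPoint hP hF hX t ht)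
  obtain ⟨u, hu, hup⟩ := exists_ultrafilter_evalEval_ne_zero hcont hab ha hb
  have hcp : ∀ᶠ t in (u : Filter ℝ), P.IsCentralPoint F t (X t) :=
    hu ((eventually_ge_atTop 0).mono fun t ht => hX t ht)
  obtain ⟨p, hp, hpx⟩ := exists_evalEval_eventually_eq_zero hu (X := X)
    (hcp.mono fun t ht => ht.1.2) P.constraintMatrix
    (pinv (P.constraintMatrix * P.constraintMatrixᵀ) * P.constraintMatrix) P.b P.C F⁻¹
    (hcp.mono fun t ht => ht.1.1) (hcp.mono fun t ht => ht.mulVec_gradient_eq hP hF) i j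
  obtain ⟨t, ht1, ht2⟩ := (hpx.and (hup p hp)).exists
  exact ht2 ht1

theorem exists_isOptimal_tendsto (hP : P.IsPositive) (hF : P.StrictlyFeasible F)
    (hX : ∀ t, 0 ≤ t → P.IsCentralPoint F t (X t)) :
    ∃ Xopt, P.IsOptimal Xopt ∧ Tendsto X atTop (𝓝 Xopt) := by
  choose x hx using exists_tendsto_apply hP hF hX
  have hlim : Tendsto X atTop (𝓝 (of x)) :=
    tendsto_pi_nhds.mpr fun i => tendsto_pi_nhds.mpr fun j => hx i j
  have hfeas : P.Feasible (of x) := by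
    have hev : ∀ᶠ t in atTop, P.StrictlyFeasible (X t) :=
      (eventually_ge_atTop 0).mono fun t ht => (hX t ht).1
    exact ⟨isClosed_setOf_linearlyFeasible.mem_of_tendsto hlim (hev.mono fun t ht => ht.1),
      isClosed_setOf_posSemidef.mem_of_tendsto hlim (hev.mono fun t ht => ht.2.posSemidef)⟩
  refine ⟨of x, ⟨hfeas, fun Y hY => ?_⟩, hlim⟩
  have hC : Continuous fun Z : Matrix (Fin n) (Fin n) ℝ => (P.C * Z).trace := by fun_prop
  have h1 : Tendsto (fun t => (P.C * X t).trace) atTop (𝓝 (P.C * of x).trace) :=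
    (hC.tendsto _).comp hlim
  have h2 : Tendsto (fun t : ℝ => (P.C * Y).trace + ((F⁻¹ * Y).trace + n) / t) atTop
      (𝓝 ((P.C * Y).trace + 0)) :=
    tendsto_const_nhds.add (tendsto_const_nhds.div_atTop tendsto_id)
  rw [add_zero] at h2
  refine le_of_tendsto_of_tendsto h1 h2 ?_
  filter_upwards [eventually_gt_atTop 0] with t ht
  have h3 := (hX t ht.le).smul_gap_le hY
  have h4 := hF.2.inv.posSemidef.trace_mul_nonneg (hX t ht.le).1.2.posSemidef
  have h5 : (P.C * X t).trace - (P.C * Y).trace ≤ ((F⁻¹ * Y).trace + n) / t := by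
    rw [le_div_iff₀ ht]
    linarith
  linarith

end SDP

theorem mainTheorem1 {n m : ℕ} (P : SDP n m) (hP : P.IsPositive)
    (F : Matrix (Fin n) (Fin n) ℝ) (hF : P.StrictlyFeasible F) :
    -- the central path through `F` is well defined on `[0, ∞)`
    (∀ t : ℝ, 0 ≤ t → ∃! X, P.IsCentralPoint F t X) ∧
    -- it starts at `F`, solves the dynamic, and is the only solution starting at `F`
    (∀ X : ℝ → Matrix (Fin n) (Fin n) ℝ, (∀ t : ℝ, 0 ≤ t → P.IsCentralPoint F t (X t)) →
      X 0 = F ∧ P.SolvesSecondAnsatz (Set.Ici 0) X ∧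
      ∀ (T : ℝ) (Y : ℝ → Matrix (Fin n) (Fin n) ℝ),
        P.SolvesSecondAnsatz (Set.Ico 0 T) Y → Y 0 = F → Set.EqOn Y X (Set.Ico 0 T)) ∧
    -- the dynamic started at `F` converges to an optimal solution of the SDP
    (∀ Y : ℝ → Matrix (Fin n) (Fin n) ℝ, P.SolvesSecondAnsatz (Set.Ici 0) Y → Y 0 = F →
      ∃ Xopt, P.IsOptimal Xopt ∧ Tendsto Y atTop (𝓝 Xopt)) := by
  refine ⟨fun t ht => ?_, fun X hX => ⟨?_, SDP.solvesSecondAnsatz_of_isCentralPoint hP hF hX,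
    fun T Y hY h0 => hY.eqOn hP hF hX h0⟩, fun Y hY h0 => ?_⟩
  · obtain ⟨X, hX⟩ := SDP.exists_isCentralPoint hP hF ht
    exact ⟨X, hX, fun Y hY => hX.unique hY⟩
  · exact hF.isCentralPoint_zero.unique (hX 0 le_rfl)
  · choose! X hX using fun (t : ℝ) (ht : 0 ≤ t) => SDP.exists_isCentralPoint hP hF ht
    obtain ⟨Xopt, hopt, hlim⟩ := SDP.exists_isOptimal_tendsto hP hF hX
    refine ⟨Xopt, hopt, hlim.congr' ?_⟩
    filter_upwards [eventually_ge_atTop 0] with t ht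
    have hY' : P.SolvesSecondAnsatz (Set.Ico 0 (t + 1)) Y := fun s hs =>
      (hY s hs.1).mono Set.Ico_subset_Ici_self
    exact (hY'.eqOn hP hF hX h0 ⟨ht, by linarith⟩).symm
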